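/- **Setting.** One item is sold to three buyers whose nonnegative values are independent, $\mathbf F=\mathbb F_1\times\mathbb F_2\times\mathbb F_3$. For a distribution $\mathbb G$ on $\mathbb R$ let $\Pi_2(\mathbb G)$ be the set of all such $\mathbf F$ for which the second-largest value $v_{(2)}$ has distribution $\mathbb G$. A mechanism is a (possibly randomized) measurable direct mechanism $\mathcal M$ that sells at most one item and is dominant-strategy truthful and ex-post individually rational on nonnegative values; $\mathrm{Rev}(\mathcal M,\mathbf F)$ is its expected total payment, $\mathrm{opt}(\mathbf F)=\sup_{\mathcal M}\mathrm{Rev}(\mathcal M,\mathbf F)$, and $R_2(\mathbb G)=\sup_{\mathcal M}\inf_{\mathbf F\in\Pi_2(\mathbb G)}\mathrm{Rev}(\mathcal M,\mathbf F)$. Let $\mathsf{SPA}$ be the second-price auction without reserve. Fix $q\in(0,1)$ with $3q^2-2q^3\ge \tfrac34$. Let $\mathbb F_{\mathrm{disc}}$ take the value $1$ with probability $q$ and $2$ with probability $1-q$, and let $\mathbb F_{\mathrm{reg}}$ have the distribution function $$\mathbb F_{\mathrm{reg}}(v)=0\ (v<1),\qquad \mathbb F_{\mathrm{reg}}(v)=\frac{v-1}{v-2+1/q}\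 (1\le v<2),\qquad \mathbb F_{\mathrm{reg}}(v)=1\ (v\ge 2).$$ Let $\mathbb G_{\mathrm{disc}}$, $\mathbb G_{\mathrm{reg}}$ be the distributions of the second-largest of three i.i.d. draws from $\mathbb F_{\mathrm{disc}}$, $\mathbb F_{\mathrm{reg}}$. Let $\mathsf{Myerson}(\mathbb F_{\mathrm{reg}}^3)$ be the auction that gives the item to the buyer with the highest virtual value $\varphi(v_i)$, provided it is nonnegative, and charges the minimum winning bid, where $\varphi(v)=v-\frac{1-\mathbb F_{\mathrm{reg}}(v)}{f_{\mathrm{reg}}(v)}$ with $f_{\mathrm{reg}}$ the right derivative of $\mathbb F_{\mathrm{reg}}$ (so $\varphi=-\infty$ on $[0,1)$, $\varphi= 2-1/q$ on $[1,2)$, and $\varphi(v)=v$ for $v\ge2$); hence all bids in $[1,2)$ are pooled. Ties are broken by a priority order of the buyers that is fixed or drawn at random from an arbitrary fixed distribution (in particular lexicographically or uniformly at random). **Proposition.** 1. $R_2(\mathbb G_{\mathrm{disc}})<\mathrm{opt}(\mathbb F_{\mathrm{disc}}^3)$. 2. $\mathsf{SPA}$ and, for every such tie-breaking rule, $\mathsf{Myerson}(\mathbb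 F_{\mathrm{reg}}^3)$ are mechanisms in the above sense, $\mathrm{Rev}(\mathsf{Myerson}(\mathbb F_{\mathrm{reg}}^3),\mathbb F_{\mathrm{reg}}^3)=\mathrm{opt}(\mathbb F_{\mathrm{reg}}^3)$, and $$R_2(\mathbb G_{\mathrm{reg}})=\min_{\mathbf F\in\Pi_2(\mathbb G_{\mathrm{reg}})}\mathrm{Rev}(\mathsf{SPA},\mathbf F)>\inf_{\mathbf F\in\Pi_2(\mathbb G_{\mathrm{reg}})}\mathrm{Rev}\big(\mathsf{Myerson}(\mathbb F_{\mathrm{reg}}^3),\mathbf F\big).$$ -/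

import Mathlib

open MeasureTheory Set

namespace OrderStatAuction

/-- `kthLargest k v` is the `k`-th largest of the numbers `v 0, …, v (n - 1)`, for `1 ≤ k ≤ n`
(so `kthLargest 1 v` is the maximum): the largest `t` such that at least `k` of them are `≥ t`. -/
noncomputable def kthLargest {n : ℕ} (k : ℕ) (v : Fin n → ℝ) : ℝ :=
  sSup {t : ℝ | k ≤ Nat.card {i : Fin n // t ≤ v i}}

/-- The law of the `k`-th largest value when the values are independent with marginals `F i`. -/
noncomputable def orderStatLaw {n : ℕ} (k : ℕ) (F : Fin n → Measure ℝ) : Measure ℝ :=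
  (Measure.pi F).map (kthLargest k)

/-- The ambiguity set: all `n`-tuples of probability distributions of nonnegative values for which
the `k`-th largest of independent draws has law `G`. -/
def ambiguitySet (n k : ℕ) (G : Measure ℝ) : Set (Fin n → Measure ℝ) :=
  {F | (∀ i, IsProbabilityMeasure (F i) ∧ F i (Iio 0) = 0) ∧ orderStatLaw k F = G}

/-- Raw data of a (randomized) direct mechanism for one item and `n` buyers: the winning
probabilities and the (expected) payments as functions of the reported values. -/
structure Mechanism (n : ℕ) where
  alloc : (Fin n → ℝ) → Fin n → ℝ
  pay : (Fin n → ℝ) → Fin n → ℝ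

/-- Admissible mechanisms on nonnegative values: at most one item is sold, truthful reporting is a
dominant strategy, participation is ex-post rational, and the rules are measurable. -/
structure Mechanism.Admissible {n : ℕ} (M : Mechanism n) : Prop where
  alloc_nonneg : ∀ v, 0 ≤ v → ∀ i, 0 ≤ M.alloc v i
  alloc_sum_le_one : ∀ v, 0 ≤ v → ∑ i, M.alloc v i ≤ 1
  truthful : ∀ v, 0 ≤ v → ∀ i, ∀ z : ℝ, 0 ≤ z →
    v i * M.alloc (Function.update v i z) i - M.pay (Function.update v i z) i
      ≤ v i * M.alloc v i - M.pay v i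
  rational : ∀ v, 0 ≤ v → ∀ i, 0 ≤ v i * M.alloc v i - M.pay v i
  measurable_alloc : Measurable M.alloc
  measurable_pay : Measurable M.pay

/-- Expected total payment when the values are independent with marginals `F i`, as an extended
real: integral of the positive part minus integral of the negative part (`⊥` for `⊤ - ⊤`). -/
noncomputable def revenue {n : ℕ} (M : Mechanism n) (F : Fin n → Measure ℝ) : EReal :=
  ((∫⁻ v, ENNReal.ofReal (∑ i, M.pay v i) ∂(Measure.pi F) : ENNReal) : EReal)
    - ((∫⁻ v, ENNReal.ofReal (-∑ i, M.pay v i) ∂(Measure.pi F) : ENNReal) : EReal)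

/-- The optimal expected revenue when the marginals `F i` are known. -/
noncomputable def opt {n : ℕ} (F : Fin n → Measure ℝ) : EReal :=
  ⨆ M : {M : Mechanism n // M.Admissible}, revenue M.1 F

/-- The worst-case expected revenue of `M` over the ambiguity set. -/
noncomputable def worstCase {n : ℕ} (M : Mechanism n) (k : ℕ) (G : Measure ℝ) : EReal :=
  ⨅ F ∈ ambiguitySet n k G, revenue M F

/-- The robust (max-min) revenue when the `k`-th largest of `n` values is known to have law `G`. -/
noncomputable def robustRevenue (n k : ℕ) (G : Measure ℝ) : EReal :=
  ⨆ M : {M : Mechanism n // M.Admissible}, worstCase M.1 k G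

open Classical in
/-- Second-price auction with reserve `r` (ties are won by the smallest index). -/
noncomputable def secondPrice (n : ℕ) (r : ℝ) : Mechanism n where
  alloc v i := if r ≤ v i ∧ ∀ j, j ≠ i → v j < v i ∨ (v j = v i ∧ i < j) then 1 else 0
  pay v i := if r ≤ v i ∧ ∀ j, j ≠ i → v j < v i ∨ (v j = v i ∧ i < j)
    then max r (kthLargest 2 v) else 0

/-- The virtual value `v - (1 - F(v)) / f(v)`, where the density `f(v)` is the right derivative of
the distribution function; it is `⊥` where `f(v) = 0` and `F(v) < 1`, and `v` where `F(v) = 1`. -/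
noncomputable def virtualValue (μ : Measure ℝ) (v : ℝ) : EReal :=
  (v : EReal) - ((ENNReal.ofReal (1 - ProbabilityTheory.cdf μ v) /
    ENNReal.ofReal (derivWithin (ProbabilityTheory.cdf μ) (Ici v) v) : ENNReal) : EReal)

/-- Buyer `i` has the highest virtual value, which is nonnegative; a tie is won by the buyer who
comes first in the priority order `π`. -/
def WinsMyerson {n : ℕ} (μ : Measure ℝ) (π : Equiv.Perm (Fin n)) (v : Fin n → ℝ) (i : Fin n) :
    Prop :=
  0 ≤ virtualValue μ (v i) ∧ ∀ j, j ≠ i → virtualValue μ (v j) < virtualValue μ (v i) ∨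
    (virtualValue μ (v j) = virtualValue μ (v i) ∧ π i < π j)

/-- The smallest bid with which buyer `i` still wins against the other bids in `v`. -/
noncomputable def minWinningBid {n : ℕ} (μ : Measure ℝ) (π : Equiv.Perm (Fin n)) (v : Fin n → ℝ)
    (i : Fin n) : ℝ :=
  sInf {z : ℝ | 0 ≤ z ∧ WinsMyerson μ π (Function.update v i z) i}

open Classical in
/-- Myerson's auction for `n` i.i.d. buyers with regular value distribution `μ`: the buyer with the
highest virtual value wins, if it is nonnegative, and pays the minimum winning bid. Ties are broken
by a priority order drawn with probabilities `w` (a point mass at the identity gives lexicographic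
tie-breaking, equal weights give uniform tie-breaking). -/
noncomputable def myerson {n : ℕ} (μ : Measure ℝ) (w : Equiv.Perm (Fin n) → ℝ) : Mechanism n where
  alloc v i := ∑ π, w π * if WinsMyerson μ π v i then 1 else 0
  pay v i := ∑ π, w π * if WinsMyerson μ π v i then minWinningBid μ π v i else 0

/-- The two-point distribution: value `1` with probability `q`, value `2` otherwise. -/
noncomputable def Fdisc (q : ℝ) : Measure ℝ :=
  ENNReal.ofReal q • Measure.dirac 1 + ENNReal.ofReal (1 - q) • Measure.dirac 2

noncomputable def regCDF (q v : ℝ) : ℝ :=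
  if v < 1 then 0 else if v < 2 then (v - 1) / (v - 2 + 1 / q) else 1

lemma regCDF_den_pos {q v : ℝ} (h0 : 0 < q) (h1 : q < 1) (hv : 1 ≤ v) : 0 < v - 2 + 1 / q := by
  have : 1 < 1 / q := by rw [lt_div_iff₀ h0]; linarith
  linarith

lemma regCDF_mono {q : ℝ} (h0 : 0 < q) (h1 : q < 1) : Monotone (regCDF q) := by
  have hc : 1 < 1 / q := by rw [lt_div_iff₀ h0]; linarith
  intro x y hxy
  unfold regCDF
  split_ifs with a b c d e f
  · exact le_rfl
  · exact div_nonneg (by linarith) (regCDF_den_pos h0 h1 (by linarith)).le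
  · exact zero_le_one
  · linarith
  · have := regCDF_den_pos (v := x) h0 h1 (by linarith)
    have := regCDF_den_pos (v := y) h0 h1 (by linarith)
    rw [div_le_div_iff₀ (by assumption) (by assumption)]
    nlinarith [mul_nonneg (sub_nonneg.2 hxy) (sub_nonneg.2 hc.le)]
  · have := regCDF_den_pos (v := x) h0 h1 (by linarith)
    rw [div_le_one this]
    linarith
  all_goals linarith

lemma regCDF_right_cont {q : ℝ} (h0 : 0 < q) (h1 : q < 1) (x : ℝ) :
    ContinuousWithinAt (regCDF q) (Ici x) x := by
  rcases lt_or_ge x 1 with hx | hx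
  · apply ContinuousAt.continuousWithinAt
    have : regCDF q =ᶠ[nhds x] fun _ => 0 := by
      filter_upwards [Iio_mem_nhds hx] with y hy
      simp only [mem_Iio] at hy
      simp [regCDF, hy]
    exact continuousAt_const.congr this.symm
  rcases lt_or_ge x 2 with hx2 | hx2
  · have hd := regCDF_den_pos h0 h1 hx
    have hcont : ContinuousWithinAt (fun y : ℝ => (y - 1) / (y - 2 + 1 / q)) (Ici x) x := by
      apply ContinuousAt.continuousWithinAt
      exact ContinuousAt.div (by fun_prop) (by fun_prop) hd.ne'
    refine hcont.congr_of_eventuallyEq ?_ ?_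
    · filter_upwards [self_mem_nhdsWithin, mem_nhdsWithin_of_mem_nhds (Iio_mem_nhds hx2)] with y h h'
      simp only [mem_Ici, mem_Iio] at h h'
      simp [regCDF, not_lt.2 (hx.trans h), h']
    · simp [regCDF, not_lt.2 hx, hx2]
  · have hone : ∀ y : ℝ, 2 ≤ y → regCDF q y = 1 := fun y hy => by
      rw [regCDF, if_neg (by linarith), if_neg (by linarith)]
    exact continuousWithinAt_const.congr (fun y hy => hone y (hx2.trans hy)) (hone x hx2)

noncomputable def regStieltjes (q : ℝ) (h0 : 0 < q) (h1 : q < 1) : StieltjesFunction ℝ where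
  toFun := regCDF q
  mono' := regCDF_mono h0 h1
  right_continuous' := regCDF_right_cont h0 h1

/-- The distribution on `[1, 2]` with distribution function `regCDF q`. -/
noncomputable def Freg (q : ℝ) (h0 : 0 < q) (h1 : q < 1) : Measure ℝ :=
  (regStieltjes q h0 h1).measure

end OrderStatAuction

open OrderStatAuction

/-! Write `p = √((1 - q)² (1 + 2q))`, so that `p²` is the probability that the second-largest of
three i.i.d. values is `2`, under `Fdisc q` as well as under `Freg`. Everything rests on comparing
two environments with the same law of the second-largest value: three i.i.d. buyers, where optimal
revenue is `2 - q²`, and two i.i.d. buyers plus a buyer of value `0` (`twoBuyers`), where the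
relevant revenue is at most `1 + p`. The second is smaller because `p² = (1 - q)² (1 + 2q) < (1 -
q)² (1 + q)² = (1 - q²)²`. The hypothesis on `q` says exactly `p ≤ 1/2`, which makes the virtual
value `2 - 1/(1 - p)` of the low type of `Fdisc (1 - p)` nonnegative.

Upper bounds are virtual surplus bounds. Under `Fdisc r` or `Freg` the virtual value is constant
below `2` and equals `2` at `2` (`virtualBound_Fdisc`, `virtualBound_Freg`), so revenue is at most
the larger level minus a correction on the event that all values are below `2`
(`opt_le_of_two_level`). This gives `2 - q²` for three draws from `Freg` and `1 + p` for `twoBuyers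
(Fdisc (1 - p))`.

On values in `[1, 2]`, Myerson's auction for `Freg` pools `[1, 2)`. Its winner pays `1` unless a
buyer other than the one with priority bids `2` (`sum_myerson_pay`). It therefore earns `2 - q²`
from three i.i.d. buyers with mass `q` below `2`, including draws from `Fdisc q`, but only `1 + p`
from the two-buyer environment built from `minRoot`. This yields the strict inequality for `Fdisc`
and the fragility of Myerson's auction.

The second-price auction always collects the second-largest value, so its revenue is constant on the
ambiguity set. For `Freg` this constant is `2 - q²` (`le_revenue_secondPrice_Freg` supplies the
needed bound), which equals the optimal revenue against the i.i.d. member of the set. No mechanism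
can have a better worst case. -/

namespace OrderStatAuction

/-! ### The median of three numbers -/

/-- The second largest of three numbers. -/
noncomputable def median (v : Fin 3 → ℝ) : ℝ :=
  max (max (min (v 0) (v 1)) (min (v 0) (v 2))) (min (v 1) (v 2))

lemma kthLargest_two_eq_median : kthLargest (n := 3) 2 = median := by
  funext v
  have h : {t : ℝ | 2 ≤ Nat.card {i : Fin 3 // t ≤ v i}} = Iic (median v) := by
    ext t
    rw [mem_ofPred_eq, Nat.card_eq_fintype_card, Fintype.card_subtype, Finset.card_filter,
      Fin.sum_univ_three]
    simp only [median, mem_Iic, le_max_iff, le_min_iff]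
    by_cases h0 : t ≤ v 0 <;> by_cases h1 : t ≤ v 1 <;> by_cases h2 : t ≤ v 2 <;> simp [h0, h1, h2]
  rw [kthLargest, h, csSup_Iic]

lemma measurable_median : Measurable median := by
  unfold median
  fun_prop

/-- At least two of the three coordinates lie in `A`. -/
def TwoIn (A : Set ℝ) (v : Fin 3 → ℝ) : Prop :=
  (v 0 ∈ A ∧ v 1 ∈ A) ∨ (v 0 ∈ A ∧ v 2 ∈ A) ∨ (v 1 ∈ A ∧ v 2 ∈ A)

lemma lt_median_iff (t : ℝ) (v : Fin 3 → ℝ) : t < median v ↔ TwoIn (Ioi t) v := by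
  simp only [median, TwoIn, lt_max_iff, lt_min_iff, mem_Ioi, or_assoc]

lemma le_median_iff (t : ℝ) (v : Fin 3 → ℝ) : t ≤ median v ↔ TwoIn (Ici t) v := by
  simp only [median, TwoIn, le_max_iff, le_min_iff, mem_Ici, or_assoc]

lemma pi_twoIn (F : Fin 3 → Measure ℝ) [∀ i, IsProbabilityMeasure (F i)] {A : Set ℝ}
    (hA : MeasurableSet A) :
    Measure.pi F {v | TwoIn A v} =
      F 0 A * F 1 A + F 0 A * F 1 Aᶜ * F 2 A + F 0 Aᶜ * F 1 A * F 2 A := by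
  -- A disjoint decomposition: buyers 0 and 1 in `A`; or 0 and 2 but not 1; or 1 and 2 but not 0.
  have hset : {v : Fin 3 → ℝ | TwoIn A v} =
      (univ.pi ![A, A, univ] ∪ univ.pi ![A, Aᶜ, A]) ∪ univ.pi ![Aᶜ, A, A] := by
    ext v
    simp only [TwoIn, mem_ofPred_eq, mem_union, mem_univ_pi, Fin.forall_fin_succ]
    simp
    tauto
  have hm : ∀ B : Fin 3 → Set ℝ, (∀ i, MeasurableSet (B i)) → MeasurableSet (univ.pi B) :=
    fun B hB => MeasurableSet.univ_pi hB
  rw [hset, measure_union, measure_union]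
  · simp only [Measure.pi_pi, Fin.prod_univ_three]
    simp
  · rw [Set.disjoint_left]
    intro v h1 h2
    exact h2 1 (mem_univ _) (h1 1 (mem_univ _))
  · refine hm _ fun i => ?_
    fin_cases i <;> simp [hA]
  · rw [Set.disjoint_left]
    rintro v (h1 | h1) h2 <;> exact h2 0 (mem_univ _) (h1 0 (mem_univ _))
  · refine hm _ fun i => ?_
    fin_cases i <;> simp [hA]

lemma pi_twoIn_same (μ : Measure ℝ) [IsProbabilityMeasure μ] {A : Set ℝ} (hA : MeasurableSet A)
    {s : ℝ} (hs0 : 0 ≤ s) (hs1 : s ≤ 1) (hs : μ A = ENNReal.ofReal s) :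
    Measure.pi (fun _ : Fin 3 => μ) {v | TwoIn A v} = ENNReal.ofReal (s ^ 2 * (3 - 2 * s)) := by
  have hc : μ Aᶜ = ENNReal.ofReal (1 - s) := by
    rw [prob_compl_eq_one_sub hA, hs, ENNReal.ofReal_sub _ hs0, ENNReal.ofReal_one]
  have h1 : 0 ≤ 1 - s := by linarith
  rw [pi_twoIn _ hA, hs, hc]
  rw [← ENNReal.ofReal_mul (by positivity), ← ENNReal.ofReal_mul (by positivity),
    ← ENNReal.ofReal_mul (by positivity), ← ENNReal.ofReal_mul (by positivity),
    ← ENNReal.ofReal_mul (by positivity),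
    ← ENNReal.ofReal_add (by positivity) (by positivity),
    ← ENNReal.ofReal_add (by positivity) (by positivity)]
  congr 1
  ring

lemma orderStatLaw_two_apply (F : Fin 3 → Measure ℝ) {A : Set ℝ} (hA : MeasurableSet A) :
    orderStatLaw 2 F A = Measure.pi F (median ⁻¹' A) := by
  rw [orderStatLaw, kthLargest_two_eq_median, Measure.map_apply measurable_median hA]

lemma orderStatLaw_Ioi (F : Fin 3 → Measure ℝ) (t : ℝ) :
    orderStatLaw 2 F (Ioi t) = Measure.pi F {v | TwoIn (Ioi t) v} := by
  rw [orderStatLaw_two_apply F measurableSet_Ioi]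
  congr 1
  ext v
  exact lt_median_iff t v

lemma orderStatLaw_Ici (F : Fin 3 → Measure ℝ) (t : ℝ) :
    orderStatLaw 2 F (Ici t) = Measure.pi F {v | TwoIn (Ici t) v} := by
  rw [orderStatLaw_two_apply F measurableSet_Ici]
  congr 1
  ext v
  exact le_median_iff t v

instance (F : Fin 3 → Measure ℝ) [∀ i, IsProbabilityMeasure (F i)] :
    IsProbabilityMeasure (orderStatLaw 2 F) := by
  rw [orderStatLaw, kthLargest_two_eq_median]
  exact Measure.isProbabilityMeasure_map measurable_median.aemeasurable

lemma ext_of_Ioi_prob {μ ν : Measure ℝ} [IsProbabilityMeasure μ] [IsProbabilityMeasure ν]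
    (h : ∀ t, μ (Ioi t) = ν (Ioi t)) : μ = ν := by
  refine Measure.ext_of_Iic _ _ fun t => ?_
  rw [← compl_Ioi, prob_compl_eq_one_sub measurableSet_Ioi,
    prob_compl_eq_one_sub measurableSet_Ioi, h]

/-! ### Two i.i.d. buyers and a null buyer -/

/-- Two buyers with values distributed as `H` and one buyer with value `0`. -/
noncomputable def twoBuyers (H : Measure ℝ) : Fin 3 → Measure ℝ := ![H, H, Measure.dirac 0]

instance (H : Measure ℝ) [IsProbabilityMeasure H] (i : Fin 3) :
    IsProbabilityMeasure (twoBuyers H i) := by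
  fin_cases i <;> simp [twoBuyers] <;> infer_instance

lemma pi_twoBuyers_twoIn (H : Measure ℝ) [IsProbabilityMeasure H] {A : Set ℝ}
    (hA : MeasurableSet A) (h0 : (0 : ℝ) ∉ A) :
    Measure.pi (twoBuyers H) {v | TwoIn A v} = H A ^ 2 := by
  rw [pi_twoIn _ hA]
  simp [twoBuyers, h0, hA, sq]

/-- The median of two nonnegative values and `0` is the minimum of the two, whose tail is the square
of the common tail. At negative thresholds the null buyer also counts, but there all tails equal
`1`. -/
lemma twoBuyers_mem_ambiguitySet {G H : Measure ℝ} [IsProbabilityMeasure G]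
    [IsProbabilityMeasure H] (hG : G (Iio 0) = 0) (hH : H (Iio 0) = 0)
    (h : ∀ t, 0 ≤ t → H (Ioi t) ^ 2 = G (Ioi t)) : twoBuyers H ∈ ambiguitySet 3 2 G := by
  have hneg : ∀ i, twoBuyers H i (Iio 0) = 0 := by
    intro i
    fin_cases i <;> simp [twoBuyers, hH]
  refine ⟨fun i => ⟨inferInstance, hneg i⟩, ext_of_Ioi_prob fun t => ?_⟩
  rw [orderStatLaw_Ioi]
  rcases le_or_gt 0 t with ht | ht
  · rw [pi_twoBuyers_twoIn H measurableSet_Ioi (by simpa using ht), h t ht]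
  · have key : ∀ μ : Measure ℝ, IsProbabilityMeasure μ → μ (Iio 0) = 0 → μ (Ioi t) = 1 := by
      intro μ _ hμ
      have : μ (Iic t) = 0 := measure_mono_null (fun x hx => lt_of_le_of_lt hx ht) hμ
      rw [← compl_Iic, prob_compl_eq_one_sub measurableSet_Iic, this, tsub_zero]
    have hc : ∀ i, twoBuyers H i (Ioi t) = 1 := fun i => key _ inferInstance (hneg i)
    rw [pi_twoIn _ measurableSet_Ioi, key G inferInstance hG, hc, hc, hc,
      prob_compl_eq_one_sub measurableSet_Ioi, prob_compl_eq_one_sub measurableSet_Ioi, hc, hc]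
    simp

/-! ### The second-price auction -/

lemma secondPrice_wins_imp {v : Fin 3 → ℝ} {i j : Fin 3} (hij : j ≠ i)
    (hi : ∀ j, j ≠ i → v j < v i ∨ (v j = v i ∧ i < j)) :
    ¬ ∀ k, k ≠ j → v k < v j ∨ (v k = v j ∧ j < k) := by
  intro hj
  rcases hi j hij with h | h <;> rcases hj i hij.symm with h' | h'
  · linarith
  · linarith [h'.1]
  · linarith [h.1]
  · exact absurd h.2 (not_lt.2 h'.2.le)

lemma exists_secondPrice_winner (v : Fin 3 → ℝ) :
    ∃ i, ∀ j, j ≠ i → v j < v i ∨ (v j = v i ∧ i < j) := by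
  by_cases h0 : v 1 ≤ v 0 ∧ v 2 ≤ v 0
  · refine ⟨0, fun j hj => ?_⟩
    fin_cases j
    · exact absurd rfl hj
    · exact (lt_or_eq_of_le h0.1).imp id fun h => ⟨h, by decide⟩
    · exact (lt_or_eq_of_le h0.2).imp id fun h => ⟨h, by decide⟩
  · by_cases h1 : v 2 ≤ v 1
    · refine ⟨1, fun j hj => ?_⟩
      fin_cases j
      · left; by_contra hc; exact h0 ⟨not_lt.1 hc, h1.trans (not_lt.1 hc)⟩
      · exact absurd rfl hj
      · exact (lt_or_eq_of_le h1).imp id fun h => ⟨h, by decide⟩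
    · refine ⟨2, fun j hj => ?_⟩
      push Not at h1
      fin_cases j
      · left; by_contra hc; exact h0 ⟨h1.le.trans (not_lt.1 hc), not_lt.1 hc⟩
      · exact Or.inl h1
      · exact absurd rfl hj

/-- The highest of the values other than that of buyer `i`. -/
noncomputable def highestOther (v : Fin 3 → ℝ) (i : Fin 3) : ℝ := max (v (i + 1)) (v (i + 2))

lemma highestOther_update (v : Fin 3 → ℝ) (i : Fin 3) (z : ℝ) :
    highestOther (Function.update v i z) i = highestOther v i := by
  fin_cases i <;> simp [highestOther, Function.update_of_ne]

lemma le_highestOther {v : Fin 3 → ℝ} {i j : Fin 3} (h : j ≠ i) : v j ≤ highestOther v i := by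
  fin_cases i <;> fin_cases j <;> simp_all [highestOther]

lemma highestOther_eq (v : Fin 3 → ℝ) (i : Fin 3) : ∃ j, j ≠ i ∧ highestOther v i = v j := by
  rcases max_choice (v (i + 1)) (v (i + 2)) with h | h
  · exact ⟨i + 1, by fin_cases i <;> decide, h⟩
  · exact ⟨i + 2, by fin_cases i <;> decide, h⟩

lemma median_eq_highestOther {v : Fin 3 → ℝ} {i : Fin 3} (h : ∀ j, j ≠ i → v j ≤ v i) :
    median v = highestOther v i := by
  fin_cases i
  · have h1 := h 1 (by decide)
    have h2 := h 2 (by decide)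
    simp only [Fin.zero_eta, Fin.isValue, median, highestOther, zero_add] at *
    grind
  · have h1 := h 0 (by decide)
    have h2 := h 2 (by decide)
    simp only [Fin.mk_one, Fin.isValue, median, highestOther, Fin.reduceAdd] at *
    grind
  · have h1 := h 0 (by decide)
    have h2 := h 1 (by decide)
    simp only [Fin.reduceFinMk, Fin.isValue, median, highestOther, Fin.reduceAdd] at *
    grind

lemma nonneg_median {v : Fin 3 → ℝ} (hv : 0 ≤ v) : 0 ≤ median v := by
  have h0 := hv 0
  have h1 := hv 1
  simp only [Pi.zero_apply] at h0 h1
  simp [median, h0, h1]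

lemma secondPrice_pay_sum {v : Fin 3 → ℝ} (hv : 0 ≤ v) :
    ∑ i, (secondPrice 3 0).pay v i = median v := by
  obtain ⟨i, hi⟩ := exists_secondPrice_winner v
  rw [Finset.sum_eq_single i]
  · simp only [secondPrice]
    rw [if_pos ⟨hv i, hi⟩, kthLargest_two_eq_median, max_eq_right (nonneg_median hv)]
  · intro j _ hji
    simp only [secondPrice]
    rw [if_neg fun h => secondPrice_wins_imp hji hi h.2]
  · simp

lemma measurableSet_secondPrice_wins (i : Fin 3) :
    MeasurableSet {v : Fin 3 → ℝ | 0 ≤ v i ∧ ∀ j, j ≠ i → v j < v i ∨ (v j = v i ∧ i < j)} := by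
  have h : {v : Fin 3 → ℝ | 0 ≤ v i ∧ ∀ j, j ≠ i → v j < v i ∨ (v j = v i ∧ i < j)} =
      {v | 0 ≤ v i} ∩ ⋂ j, ⋂ (_ : j ≠ i), ({v | v j < v i} ∪ ({v | v j = v i} ∩ {_v | i < j})) := by
    ext v
    simp
  rw [h]
  refine (measurableSet_le measurable_const (measurable_pi_apply i)).inter ?_
  refine MeasurableSet.iInter fun j => MeasurableSet.iInter fun _ => ?_
  exact (measurableSet_lt (measurable_pi_apply j) (measurable_pi_apply i)).union
    ((measurableSet_eq_fun (measurable_pi_apply j) (measurable_pi_apply i)).inter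
      (MeasurableSet.const _))

lemma secondPrice_admissible : (secondPrice 3 0).Admissible := by
  classical
  have win : ∀ v : Fin 3 → ℝ, 0 ≤ v → ∀ i,
      (∀ j, j ≠ i → v j < v i ∨ (v j = v i ∧ i < j)) →
      (secondPrice 3 0).alloc v i = 1 ∧ (secondPrice 3 0).pay v i = highestOther v i := by
    intro v hv i hi
    simp only [secondPrice]
    rw [if_pos ⟨hv i, hi⟩, if_pos ⟨hv i, hi⟩, kthLargest_two_eq_median,
      max_eq_right (nonneg_median hv), median_eq_highestOther]
    · exact ⟨rfl, rfl⟩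
    · exact fun j hj => (hi j hj).elim le_of_lt fun h => h.1.le
  have lose : ∀ v : Fin 3 → ℝ, ∀ i, ¬ (∀ j, j ≠ i → v j < v i ∨ (v j = v i ∧ i < j)) →
      (secondPrice 3 0).alloc v i = 0 ∧ (secondPrice 3 0).pay v i = 0 := by
    intro v i hi
    simp only [secondPrice]
    rw [if_neg fun h => hi h.2, if_neg fun h => hi h.2]
    exact ⟨rfl, rfl⟩
  -- The truthful utility does not mention the tie-breaking rule: a winner in a tie gains nothing.
  -- Any deviation yields either `v i - highestOther v i` or `0`, so this formula settles
  -- truthfulness and rationality together.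
  have util : ∀ v : Fin 3 → ℝ, 0 ≤ v → ∀ i,
      v i * (secondPrice 3 0).alloc v i - (secondPrice 3 0).pay v i =
        max (v i - highestOther v i) 0 := by
    intro v hv i
    by_cases hi : ∀ j, j ≠ i → v j < v i ∨ (v j = v i ∧ i < j)
    · rw [(win v hv i hi).1, (win v hv i hi).2, mul_one, max_eq_left]
      obtain ⟨j, hj, hj'⟩ := highestOther_eq v i
      rw [hj']
      rcases hi j hj with h | h <;> linarith [h]
    · rw [(lose v i hi).1, (lose v i hi).2, mul_zero, sub_zero, max_eq_right]
      push Not at hi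
      obtain ⟨j, hj, hj', -⟩ := hi
      linarith [le_highestOther (v := v) hj]
  constructor
  · intro v _ i
    simp only [secondPrice]
    split_ifs <;> norm_num
  · intro v hv
    obtain ⟨i, hi⟩ := exists_secondPrice_winner v
    rw [Finset.sum_eq_single i]
    · exact (win v hv i hi).1.le
    · exact fun j _ hji => (lose v j (secondPrice_wins_imp hji hi)).1
    · simp
  · intro v hv i z hz
    rw [util v hv]
    have hu : 0 ≤ Function.update v i z := by
      intro j
      by_cases hj : j = i
      · subst hj; simpa using hz
      · simpa [hj] using hv j
    by_cases hi : ∀ j, j ≠ i → Function.update v i z j < Function.update v i z i ∨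
        (Function.update v i z j = Function.update v i z i ∧ i < j)
    · rw [(win _ hu i hi).1, (win _ hu i hi).2, highestOther_update, mul_one]
      exact le_max_left _ _
    · rw [(lose _ i hi).1, (lose _ i hi).2]
      simp
  · intro v hv i
    rw [util v hv]
    exact le_max_right _ _
  · refine measurable_pi_lambda _ fun i => ?_
    exact Measurable.ite (measurableSet_secondPrice_wins i) measurable_const measurable_const
  · refine measurable_pi_lambda _ fun i => ?_
    refine Measurable.ite (measurableSet_secondPrice_wins i) ?_ measurable_const
    rw [kthLargest_two_eq_median]
    exact measurable_const.max measurable_median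

lemma ae_pi_nonneg {n : ℕ} {F : Fin n → Measure ℝ} [∀ i, IsProbabilityMeasure (F i)]
    (hF : ∀ i, F i (Iio 0) = 0) : ∀ᵐ v ∂Measure.pi F, 0 ≤ v := by
  have : ∀ i, ∀ᵐ v ∂Measure.pi F, 0 ≤ v i := by
    intro i
    have h : ∀ᵐ x ∂F i, 0 ≤ x := by
      rw [ae_iff]
      simpa [Iio] using hF i
    exact Measure.tendsto_eval_ae_ae.eventually h
  filter_upwards [ae_all_iff.2 this] with v hv i using hv i

/-- The total payment is the median, so the revenue depends on `F` only through the law of the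
second-largest value. -/
lemma revenue_secondPrice {F : Fin 3 → Measure ℝ} [∀ i, IsProbabilityMeasure (F i)]
    (hF : ∀ i, F i (Iio 0) = 0) :
    revenue (secondPrice 3 0) F = ((∫⁻ x, ENNReal.ofReal x ∂orderStatLaw 2 F : ENNReal) : EReal) := by
  have h1 : ∫⁻ v, ENNReal.ofReal (∑ i, (secondPrice 3 0).pay v i) ∂(Measure.pi F) =
      ∫⁻ x, ENNReal.ofReal x ∂orderStatLaw 2 F := by
    rw [orderStatLaw, kthLargest_two_eq_median,
      lintegral_map ENNReal.measurable_ofReal measurable_median]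
    refine lintegral_congr_ae ?_
    filter_upwards [ae_pi_nonneg hF] with v hv
    rw [secondPrice_pay_sum hv]
  have h2 : ∫⁻ v, ENNReal.ofReal (-∑ i, (secondPrice 3 0).pay v i) ∂(Measure.pi F) = 0 := by
    rw [← lintegral_zero (μ := Measure.pi F)]
    refine lintegral_congr_ae ?_
    filter_upwards [ae_pi_nonneg hF] with v hv
    rw [secondPrice_pay_sum hv, ENNReal.ofReal_of_nonpos]
    linarith [nonneg_median hv]
  rw [revenue, h1, h2]
  simp

lemma worstCase_secondPrice {F : Fin 3 → Measure ℝ} {G : Measure ℝ}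
    (hF : F ∈ ambiguitySet 3 2 G) :
    worstCase (secondPrice 3 0) 2 G = revenue (secondPrice 3 0) F := by
  have key : ∀ F' ∈ ambiguitySet 3 2 G, revenue (secondPrice 3 0) F' =
      ((∫⁻ x, ENNReal.ofReal x ∂G : ENNReal) : EReal) := by
    intro F' hF'
    have := fun i => (hF'.1 i).1
    rw [revenue_secondPrice fun i => (hF'.1 i).2, hF'.2]
  refine le_antisymm (iInf₂_le F hF) (le_iInf₂ fun F' hF' => ?_)
  rw [key F hF, key F' hF']

/-! ### Upper bounds on revenue by virtual surplus -/

/-- A truthful and individually rational mechanism facing one buyer. -/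
structure SingleBuyer (x p : ℝ → ℝ) : Prop where
  nonneg : ∀ s, 0 ≤ s → 0 ≤ x s
  le_one : ∀ s, 0 ≤ s → x s ≤ 1
  truthful : ∀ s, 0 ≤ s → ∀ z, 0 ≤ z → s * x z - p z ≤ s * x s - p s
  rational : ∀ s, 0 ≤ s → 0 ≤ s * x s - p s
  measurable_alloc : Measurable x
  measurable_pay : Measurable p

/-- The expected payment of a buyer with value distribution `μ` is at most the expected value of
`φ` times the winning probability, whatever the mechanism. -/
def VirtualBound (μ : Measure ℝ) (φ : ℝ → ℝ) : Prop :=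
  ∀ x p, SingleBuyer x p →
    ∫⁻ s, ENNReal.ofReal (p s) ∂μ ≤ ∫⁻ s, ENNReal.ofReal (φ s * x s) ∂μ

lemma update_sup_zero {n : ℕ} (v : Fin n → ℝ) (i : Fin n) (s : ℝ) :
    Function.update v i s ⊔ 0 = Function.update (v ⊔ 0) i (s ⊔ 0) := by
  funext j
  by_cases h : j = i
  · subst h; simp
  · simp [h]

lemma measurable_sup_zero {n : ℕ} : Measurable fun v : Fin n → ℝ => v ⊔ 0 :=
  measurable_pi_lambda _ fun i => (measurable_pi_apply i).sup_const 0

/-- Bids are truncated at `0` because admissibility constrains `M` only on nonnegative profiles;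
this way the other bids can be arbitrary reals, as integration over one coordinate requires. -/
lemma Mechanism.Admissible.singleBuyer {n : ℕ} {M : Mechanism n} (hM : M.Admissible)
    (v : Fin n → ℝ) (i : Fin n) :
    SingleBuyer (fun s => M.alloc (Function.update v i s ⊔ 0) i)
      (fun s => M.pay (Function.update v i s ⊔ 0) i) := by
  have h0 : ∀ s : ℝ, (0 : Fin n → ℝ) ≤ Function.update v i s ⊔ 0 := fun s => le_sup_right
  have hval : ∀ s : ℝ, 0 ≤ s → (Function.update v i s ⊔ 0) i = s := fun s hs => by simp [hs]
  have hmeas : Measurable fun s : ℝ => Function.update v i s ⊔ 0 :=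
    measurable_sup_zero.comp (measurable_update v)
  constructor
  · exact fun s _ => hM.alloc_nonneg _ (h0 s) i
  · intro s _
    refine le_trans ?_ (hM.alloc_sum_le_one _ (h0 s))
    exact Finset.single_le_sum (fun j _ => hM.alloc_nonneg _ (h0 s) j) (Finset.mem_univ i)
  · intro s hs z hz
    have h := hM.truthful _ (h0 s) i z hz
    rw [hval s hs] at h
    have hu : Function.update (Function.update v i s ⊔ 0) i z = Function.update v i z ⊔ 0 := by
      rw [update_sup_zero, update_sup_zero, Function.update_idem, sup_of_le_left hz]
    rwa [hu] at h
  · intro s hs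
    have h := hM.rational _ (h0 s) i
    rwa [hval s hs] at h
  · exact (measurable_pi_apply i).comp (hM.measurable_alloc.comp hmeas)
  · exact (measurable_pi_apply i).comp (hM.measurable_pay.comp hmeas)

/-- Myerson's argument: each expected payment is at most the expected virtual value of the
allocation, and since winning probabilities sum to at most `1`, the virtual surplus is at most any
pointwise bound on the virtual values. -/
lemma revenue_le_of_virtualBound {n : ℕ} {F : Fin n → Measure ℝ} [∀ i, IsProbabilityMeasure (F i)]
    (hF : ∀ i, F i (Iio 0) = 0) {M : Mechanism n} (hM : M.Admissible) {φ : Fin n → ℝ → ℝ}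
    (hφ : ∀ i, Measurable (φ i)) (hφ0 : ∀ i s, 0 ≤ φ i s) (hb : ∀ i, VirtualBound (F i) (φ i))
    {B : (Fin n → ℝ) → ℝ} (hB0 : ∀ v, 0 ≤ B v) (hB : ∀ᵐ v ∂Measure.pi F, ∀ i, φ i (v i) ≤ B v) :
    revenue M F ≤ ((∫⁻ v, ENNReal.ofReal (B v) ∂Measure.pi F : ENNReal) : EReal) := by
  have hsup := measurable_sup_zero (n := n)
  have hpay : ∀ i, Measurable fun v : Fin n → ℝ => M.pay (v ⊔ 0) i := fun i =>
    (measurable_pi_apply i).comp (hM.measurable_pay.comp hsup)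
  have halloc : ∀ i, Measurable fun v : Fin n → ℝ => M.alloc (v ⊔ 0) i := fun i =>
    (measurable_pi_apply i).comp (hM.measurable_alloc.comp hsup)
  have hone : ∀ i, ∫⁻ v, ENNReal.ofReal (M.pay (v ⊔ 0) i) ∂Measure.pi F ≤
      ∫⁻ v, ENNReal.ofReal (φ i (v i) * M.alloc (v ⊔ 0) i) ∂Measure.pi F := by
    intro i
    -- Integrating over the `i`-th value first, with the others fixed, reduces the claim to the
    -- one-buyer bound.
    refine lintegral_le_of_lmarginal_le {i} (hpay i).ennreal_ofReal
      (((hφ i).comp (measurable_pi_apply i)).mul (halloc i)).ennreal_ofReal ?_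
    rw [lmarginal_singleton, lmarginal_singleton]
    intro v
    simpa using hb i _ _ (hM.singleBuyer v i)
  have hmain : ∫⁻ v, ENNReal.ofReal (∑ i, M.pay v i) ∂Measure.pi F ≤
      ∫⁻ v, ENNReal.ofReal (B v) ∂Measure.pi F := by
    calc ∫⁻ v, ENNReal.ofReal (∑ i, M.pay v i) ∂Measure.pi F
        ≤ ∫⁻ v, ∑ i, ENNReal.ofReal (M.pay (v ⊔ 0) i) ∂Measure.pi F := by
          refine lintegral_mono_ae ?_
          filter_upwards [ae_pi_nonneg hF] with v hv
          rw [sup_of_le_left hv]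
          refine ENNReal.ofReal_le_of_le_toReal ?_
          rw [ENNReal.toReal_sum fun i _ => ENNReal.ofReal_ne_top]
          exact Finset.sum_le_sum fun i _ => by
            rw [ENNReal.toReal_ofReal']; exact le_max_left _ _
      _ = ∑ i, ∫⁻ v, ENNReal.ofReal (M.pay (v ⊔ 0) i) ∂Measure.pi F :=
          lintegral_finsetSum _ fun i _ => (hpay i).ennreal_ofReal
      _ ≤ ∑ i, ∫⁻ v, ENNReal.ofReal (φ i (v i) * M.alloc (v ⊔ 0) i) ∂Measure.pi F :=
          Finset.sum_le_sum fun i _ => hone i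
      _ = ∫⁻ v, ∑ i, ENNReal.ofReal (φ i (v i) * M.alloc (v ⊔ 0) i) ∂Measure.pi F :=
          (lintegral_finsetSum _ fun i _ =>
            (((hφ i).comp (measurable_pi_apply i)).mul (halloc i)).ennreal_ofReal).symm
      _ ≤ ∫⁻ v, ENNReal.ofReal (B v) ∂Measure.pi F := by
          refine lintegral_mono_ae ?_
          filter_upwards [hB] with v hv
          have h0 : (0 : Fin n → ℝ) ≤ v ⊔ 0 := le_sup_right
          rw [← ENNReal.ofReal_sum_of_nonneg fun i _ =>
            mul_nonneg (hφ0 i _) (hM.alloc_nonneg _ h0 i)]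
          refine ENNReal.ofReal_le_ofReal ?_
          calc ∑ i, φ i (v i) * M.alloc (v ⊔ 0) i
              ≤ ∑ i, B v * M.alloc (v ⊔ 0) i := Finset.sum_le_sum fun i _ =>
                mul_le_mul_of_nonneg_right (hv i) (hM.alloc_nonneg _ h0 i)
            _ = B v * ∑ i, M.alloc (v ⊔ 0) i := (Finset.mul_sum _ _ _).symm
            _ ≤ B v := mul_le_of_le_one_right (hB0 v) (hM.alloc_sum_le_one _ h0)
  refine (EReal.sub_le_sub (EReal.coe_ennreal_le_coe_ennreal_iff.2 hmain)
    (EReal.coe_ennreal_nonneg _)).trans ?_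
  rw [sub_zero]

/-- The virtual surplus is at most `a` when all values are below `2`, an event of probability `b` by
independence, and at most `2` otherwise. -/
lemma opt_le_of_two_level {n : ℕ} {F : Fin n → Measure ℝ} [∀ i, IsProbabilityMeasure (F i)]
    (hF : ∀ i, F i (Iio 0) = 0) {φ : Fin n → ℝ → ℝ} (hφ : ∀ i, Measurable (φ i))
    (hφ0 : ∀ i s, 0 ≤ φ i s) (hb : ∀ i, VirtualBound (F i) (φ i)) {a : ℝ} (ha0 : 0 ≤ a) (hlow : ∀ i s, s < 2 → φ i s ≤ a) (hhigh : ∀ i s, φ i s ≤ 2)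
    {b : ℝ} (hb1 : b = ∏ i, (F i).real (Iio 2)) :
    opt F ≤ ((2 - (2 - a) * b : ℝ) : EReal) := by
  have hR : MeasurableSet (univ.pi fun _ : Fin n => Iio (2 : ℝ)) :=
    MeasurableSet.univ_pi fun _ => measurableSet_Iio
  set R := univ.pi fun _ : Fin n => Iio (2 : ℝ)
  have hbR : (Measure.pi F).real R = b := by
    rw [hb1, measureReal_def, Measure.pi_pi, ENNReal.toReal_prod]
    rfl
  refine iSup_le fun M => ?_
  refine (revenue_le_of_virtualBound hF M.2 hφ hφ0 hb
    (B := fun v => 2 - R.indicator (fun _ => 2 - a) v) ?_ ?_).trans ?_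
  · intro v
    by_cases h : v ∈ R <;> simp [h, ha0]
  · refine Filter.Eventually.of_forall fun v i => ?_
    by_cases h : v ∈ R
    · simpa [h] using hlow i _ (h i (mem_univ i))
    · simpa [h] using hhigh i _
  · have hint : Integrable (fun v => 2 - R.indicator (fun _ => 2 - a) v) (Measure.pi F) :=
      (integrable_const _).sub ((integrable_const _).indicator hR)
    rw [← ofReal_integral_eq_lintegral_ofReal hint, integral_sub (integrable_const _)
      ((integrable_const _).indicator hR), integral_indicator_const _ hR, hbR]
    · rw [EReal.coe_ennreal_ofReal, max_eq_left]
      · simp [mul_comm]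
      · have : b ≤ 1 := hbR ▸ measureReal_le_one
        have : 0 ≤ b := hbR ▸ measureReal_nonneg
        simp
        nlinarith
    · refine Filter.Eventually.of_forall fun v => ?_
      by_cases h : v ∈ R <;> simp [h, ha0]

lemma virtualBound_dirac_zero : VirtualBound (Measure.dirac 0) (fun _ => 0) := by
  intro x p h
  have := h.rational 0 le_rfl
  simp only [zero_mul, zero_sub] at this
  simp [ENNReal.ofReal_of_nonpos (show p 0 ≤ 0 by linarith)]

lemma isProbabilityMeasure_Fdisc {q : ℝ} (h0 : 0 ≤ q) (h1 : q ≤ 1) :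
    IsProbabilityMeasure (Fdisc q) := by
  constructor
  simp only [Fdisc, Measure.coe_add, Measure.coe_smul, Pi.add_apply, Pi.smul_apply, measure_univ,
    smul_eq_mul, mul_one]
  rw [← ENNReal.ofReal_add h0 (by linarith)]
  simp

/-- Rationality of type `1` gives `p 1 ≤ x 1`; the deviation of type `2` to `1` then gives `p 2 ≤ 2
* x 2 - x 1`. Taking expectations and collecting the coefficient of `x 1` produces `r * (2 - 1 /
r)`, which is nonnegative as `r ≥ 1/2`. -/
lemma virtualBound_Fdisc {r : ℝ} (h0 : 1 / 2 ≤ r) (h1 : r < 1) :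
    VirtualBound (Fdisc r) (fun s => if s < 2 then 2 - 1 / r else 2) := by
  intro x p h
  have hr : 0 < r := by linarith
  have hinv : 1 / r ≤ 2 := by rw [div_le_iff₀ hr]; linarith
  have e1 := h.rational 1 (by norm_num)
  have e2 := h.truthful 2 (by norm_num) 1 (by norm_num)
  have e3 := h.truthful 1 (by norm_num) 2 (by norm_num)
  have n1 := h.nonneg 1 (by norm_num)
  have n2 := h.nonneg 2 (by norm_num)
  simp only [Fdisc, lintegral_add_measure, lintegral_smul_measure, lintegral_dirac, smul_eq_mul]
  rw [if_pos one_lt_two, if_neg (lt_irrefl _)]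
  rw [← ENNReal.ofReal_mul hr.le, ← ENNReal.ofReal_mul hr.le, ← ENNReal.ofReal_mul (by linarith),
    ← ENNReal.ofReal_mul (by linarith)]
  have m1 : 0 ≤ (2 - 1 / r) * x 1 := mul_nonneg (by linarith) n1
  rw [← ENNReal.ofReal_add (mul_nonneg hr.le m1) (mul_nonneg (by linarith) (by linarith))]
  calc _ ≤ ENNReal.ofReal (r * x 1) + ENNReal.ofReal ((1 - r) * (2 * x 2 - x 1)) := by
        gcongr <;> linarith
    _ = ENNReal.ofReal (r * x 1 + (1 - r) * (2 * x 2 - x 1)) := by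
        rw [ENNReal.ofReal_add (by positivity) (mul_nonneg (by linarith) (by linarith))]
    _ ≤ _ := by
        refine ENNReal.ofReal_le_ofReal (le_of_eq ?_)
        field_simp
        ring

/-! ### The distribution `Freg` -/

lemma regCDF_tendsto_atBot (q : ℝ) : Filter.Tendsto (regCDF q) Filter.atBot (nhds 0) := by
  refine tendsto_const_nhds.congr' ?_
  filter_upwards [Filter.eventually_lt_atBot 1] with v hv
  simp [regCDF, hv]

lemma regCDF_tendsto_atTop (q : ℝ) : Filter.Tendsto (regCDF q) Filter.atTop (nhds 1) := by
  refine tendsto_const_nhds.congr' ?_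
  filter_upwards [Filter.eventually_ge_atTop 2] with v hv
  rw [regCDF, if_neg (by linarith), if_neg (by linarith)]

section Freg

variable {q : ℝ} (h0 : 0 < q) (h1 : q < 1)

instance isProbabilityMeasure_Freg : IsProbabilityMeasure (Freg q h0 h1) :=
  StieltjesFunction.isProbabilityMeasure _ (regCDF_tendsto_atBot q) (regCDF_tendsto_atTop q)

lemma cdf_Freg : ProbabilityTheory.cdf (Freg q h0 h1) = regStieltjes q h0 h1 :=
  ProbabilityTheory.cdf_measure_stieltjesFunction _ (regCDF_tendsto_atBot q)
    (regCDF_tendsto_atTop q)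

lemma cdf_Freg_apply (v : ℝ) : ProbabilityTheory.cdf (Freg q h0 h1) v = regCDF q v := by
  rw [cdf_Freg]
  rfl

lemma regCDF_nonneg (h0 : 0 < q) (h1 : q < 1) (v : ℝ) : 0 ≤ regCDF q v := by
  rw [← cdf_Freg_apply h0 h1]
  exact ProbabilityTheory.cdf_nonneg _ _

lemma regCDF_le_one (h0 : 0 < q) (h1 : q < 1) (v : ℝ) : regCDF q v ≤ 1 := by
  rw [← cdf_Freg_apply h0 h1]
  exact ProbabilityTheory.cdf_le_one _ _

lemma Freg_Iic (v : ℝ) : Freg q h0 h1 (Iic v) = ENNReal.ofReal (regCDF q v) := by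
  rw [← cdf_Freg_apply h0 h1, ProbabilityTheory.ofReal_cdf]

lemma Freg_Ioi (v : ℝ) : Freg q h0 h1 (Ioi v) = ENNReal.ofReal (1 - regCDF q v) := by
  rw [← compl_Iic, prob_compl_eq_one_sub measurableSet_Iic, Freg_Iic,
    ENNReal.ofReal_sub _ (regCDF_nonneg h0 h1 v), ENNReal.ofReal_one]

/-- The density of `Freg` on `[1, 2)`. -/
noncomputable def regDensity (q s : ℝ) : ℝ := (1 / q - 1) / (s - 2 + 1 / q) ^ 2

lemma measurable_regDensity (q : ℝ) : Measurable (regDensity q) := by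
  unfold regDensity
  fun_prop

lemma regDensity_nonneg (h0 : 0 < q) (h1 : q < 1) (s : ℝ) : 0 ≤ regDensity q s := by
  have : 1 < 1 / q := by rw [lt_div_iff₀ h0]; linarith
  exact div_nonneg (by linarith) (sq_nonneg _)

lemma continuousOn_regDensity (h0 : 0 < q) (h1 : q < 1) : ContinuousOn (regDensity q) (Ici 1) := by
  unfold regDensity
  refine ContinuousOn.div (by fun_prop) (by fun_prop) fun s hs => ?_
  exact pow_ne_zero _ (regCDF_den_pos h0 h1 hs).ne'

lemma hasDerivAt_regCDF_formula (h0 : 0 < q) (h1 : q < 1) {s : ℝ} (hs : 1 ≤ s) :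
    HasDerivAt (fun v => (v - 1) / (v - 2 + 1 / q)) (regDensity q s) s := by
  have hd := regCDF_den_pos h0 h1 hs
  have := ((hasDerivAt_id s).sub_const 1).div (((hasDerivAt_id s).sub_const 2).add_const (1 / q))
    hd.ne'
  refine this.congr_deriv ?_
  simp only [id, regDensity]
  congr 1
  ring

lemma integral_regDensity (h0 : 0 < q) (h1 : q < 1) {t : ℝ} (ht : 1 ≤ t) :
    ∫ s in (1 : ℝ)..t, regDensity q s = (t - 1) / (t - 2 + 1 / q) := by
  rw [intervalIntegral.integral_eq_sub_of_hasDerivAt (f := fun v => (v - 1) / (v - 2 + 1 / q))]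
  · simp
  · intro s hs
    rw [uIcc_of_le ht] at hs
    exact hasDerivAt_regCDF_formula h0 h1 hs.1
  · refine ContinuousOn.intervalIntegrable ((continuousOn_regDensity h0 h1).mono ?_)
    rw [uIcc_of_le ht]
    exact fun s hs => hs.1

lemma lintegral_regDensity (h0 : 0 < q) (h1 : q < 1) {t : ℝ} (ht : 1 ≤ t) :
    ∫⁻ s in Ioc 1 t, ENNReal.ofReal (regDensity q s) =
      ENNReal.ofReal ((t - 1) / (t - 2 + 1 / q)) := by
  rw [← integral_regDensity h0 h1 ht, intervalIntegral.integral_of_le ht,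
    ofReal_integral_eq_lintegral_ofReal]
  · have : IntervalIntegrable (regDensity q) volume 1 t := by
      refine ContinuousOn.intervalIntegrable ((continuousOn_regDensity h0 h1).mono ?_)
      rw [uIcc_of_le ht]
      exact fun s hs => hs.1
    exact (intervalIntegrable_iff_integrableOn_Ioc_of_le ht).1 this
  · exact Filter.Eventually.of_forall fun s => regDensity_nonneg h0 h1 s

/-- The distribution function has left limit `q` at `2`, hence an atom of mass `1 - q` there and a
density on the rest. -/
lemma Freg_eq_density_add_dirac :
    Freg q h0 h1 = (volume.restrict (Ioc (1 : ℝ) 2)).withDensity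
        (fun s => ENNReal.ofReal (regDensity q s)) +
      ENNReal.ofReal (1 - q) • Measure.dirac 2 := by
  refine Measure.ext_of_Iic _ _ fun t => ?_
  rw [Freg_Iic, Measure.add_apply, withDensity_apply _ measurableSet_Iic,
    Measure.restrict_restrict measurableSet_Iic, Measure.smul_apply,
    Measure.dirac_apply' _ measurableSet_Iic, inter_comm, Ioc_inter_Iic]
  rcases lt_or_ge t 1 with ht | ht
  · have h2 : (2 : ℝ) ∉ Iic t := by simp; linarith
    rw [Ioc_eq_empty (by simp [ht.le])]
    simp [regCDF, ht, h2]
  rcases lt_or_ge t 2 with ht2 | ht2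
  · have h2 : (2 : ℝ) ∉ Iic t := by simp; linarith
    rw [min_eq_right ht2.le, lintegral_regDensity h0 h1 ht]
    simp [regCDF, not_lt.2 ht, ht2, h2]
  · have h2 : (2 : ℝ) ∈ Iic t := ht2
    rw [min_eq_left ht2, lintegral_regDensity h0 h1 one_le_two, indicator_of_mem h2]
    simp only [Pi.one_apply, smul_eq_mul, mul_one]
    rw [← ENNReal.ofReal_add (by norm_num; exact h0.le) (by linarith), regCDF,
      if_neg (not_lt.2 ht), if_neg (not_lt.2 ht2)]
    congr 1
    field_simp
    ring

lemma lintegral_Freg (f : ℝ → ENNReal) (hf : Measurable f) :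
    ∫⁻ s, f s ∂Freg q h0 h1 =
      (∫⁻ s in Ioc (1 : ℝ) 2, ENNReal.ofReal (regDensity q s) * f s) +
        ENNReal.ofReal (1 - q) * f 2 := by
  rw [Freg_eq_density_add_dirac, lintegral_add_measure, lintegral_smul_measure,
    lintegral_withDensity_eq_lintegral_mul _ (measurable_regDensity q).ennreal_ofReal hf,
    lintegral_dirac' _ hf]
  rfl

lemma Freg_Ici_two : Freg q h0 h1 (Ici 2) = ENNReal.ofReal (1 - q) := by
  rw [Freg_eq_density_add_dirac, Measure.add_apply, withDensity_apply _ measurableSet_Ici,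
    Measure.restrict_restrict measurableSet_Ici, Measure.smul_apply,
    Measure.dirac_apply' _ measurableSet_Ici]
  have : Ici (2 : ℝ) ∩ Ioc 1 2 = {2} := by
    ext x
    simp only [mem_inter_iff, mem_Ici, mem_Ioc, mem_singleton_iff]
    constructor
    · rintro ⟨h, -, h'⟩; linarith
    · rintro rfl; norm_num
  rw [this]
  simp

lemma Freg_Iio_two : (Freg q h0 h1).real (Iio 2) = q := by
  rw [measureReal_def, ← compl_Ici, prob_compl_eq_one_sub measurableSet_Ici, Freg_Ici_two,
    ← ENNReal.ofReal_one, ← ENNReal.ofReal_sub _ (by linarith),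
    ENNReal.toReal_ofReal (by linarith)]
  ring

lemma Freg_ae_mem_Icc : ∀ᵐ s ∂Freg q h0 h1, s ∈ Icc (1 : ℝ) 2 := by
  rw [Freg_eq_density_add_dirac, ae_add_measure_iff]
  constructor
  · refine (withDensity_absolutelyContinuous _ _).ae_le ?_
    filter_upwards [ae_restrict_mem measurableSet_Ioc] with s hs using ⟨hs.1.le, hs.2⟩
  · refine Measure.ae_smul_measure ?_ _
    exact (ae_dirac_iff (p := fun s => s ∈ Icc (1 : ℝ) 2) measurableSet_Icc).2 (by norm_num)

end Freg

/-! ### The revenue bound for one buyer with distribution `Freg` -/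

/-- Truthfulness makes the utility a supremum of functions affine in the true value. -/
lemma SingleBuyer.convexOn_utility {x p : ℝ → ℝ} (h : SingleBuyer x p) :
    ConvexOn ℝ (Ici 0) (fun s => s * x s - p s) := by
  refine ⟨convex_Ici 0, fun a ha b hb α β hα hβ hαβ => ?_⟩
  simp only [smul_eq_mul]
  have hm : 0 ≤ α * a + β * b :=
    add_nonneg (mul_nonneg hα (mem_Ici.1 ha)) (mul_nonneg hβ (mem_Ici.1 hb))
  set m := α * a + β * b with hmdef
  have e1 := mul_le_mul_of_nonneg_left (h.truthful a ha m hm) hα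
  have e2 := mul_le_mul_of_nonneg_left (h.truthful b hb m hm) hβ
  have : m * x m - p m = α * (a * x m - p m) + β * (b * x m - p m) := by
    rw [hmdef]
    linear_combination p m * hαβ
  rw [this]
  linarith

/-- Truthfulness says that `x s` is a subgradient of the utility at `s`, hence below every slope to
the right. -/
lemma SingleBuyer.le_rightDeriv_utility {x p : ℝ → ℝ} (h : SingleBuyer x p) {s : ℝ} (hs : 0 < s) :
    x s ≤ derivWithin (fun s => s * x s - p s) (Ioi s) s := by
  have hd := h.convexOn_utility.hasDerivWithinAt_rightDeriv_of_mem_interior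
    (x := s) (by simpa using hs)
  rw [hasDerivWithinAt_iff_tendsto_slope' (notMem_Ioi.2 le_rfl)] at hd
  refine ge_of_tendsto hd ?_
  filter_upwards [self_mem_nhdsWithin] with t ht
  rw [slope_def_field, le_div_iff₀ (sub_pos.2 ht)]
  have := h.truthful t (hs.le.trans (mem_Ioi.1 ht).le) s hs.le
  linarith

/-- The integration by parts in Myerson's lemma. With utility `u`, the integrand is at most the
right derivative of `K * u s / (s + d)`, since `x` lies below the right derivative of `u`. Only this
inequality is needed, so neither differentiability of `u` nor an envelope formula enters. -/
lemma SingleBuyer.integral_le {x p : ℝ → ℝ} (h : SingleBuyer x p) {d K : ℝ} (hd : -1 < d)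
    (hi : IntegrableOn (fun s => K * x s / (s + d) -
      K * (s * x s - p s) / (s + d) ^ 2) (Icc 1 2)) (hK : 0 ≤ K) :
    ∫ s in (1 : ℝ)..2, (K * x s / (s + d) - K * (s * x s - p s) / (s + d) ^ 2) ≤
      K * (2 * x 2 - p 2) / (2 + d) - K * (1 * x 1 - p 1) / (1 + d) := by
  have hc := h.convexOn_utility
  have hint : ∀ s ∈ Icc (1 : ℝ) 2, s ∈ interior (Ici (0 : ℝ)) := fun s hs => by
    rw [interior_Ici]; exact zero_lt_one.trans_le hs.1
  have hcont : ContinuousOn (fun s => s * x s - p s) (Icc 1 2) :=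
    (hc.subset interior_subset (convex_Ici 0).interior).continuousOn isOpen_interior |>.mono hint
  refine intervalIntegral.integral_le_sub_of_hasDeriv_right_of_le
    (g := fun s => K * (s * x s - p s) / (s + d))
    (g' := fun s => (K * derivWithin (fun s => s * x s - p s) (Ioi s) s * (s + d) -
      K * (s * x s - p s) * 1) / (s + d) ^ 2) one_le_two ?_ ?_ hi ?_
  · exact (continuousOn_const.mul hcont).div (by fun_prop) fun s hs => by
      have := hs.1
      linarith
  · intro s hs
    have hs0 : s + d ≠ 0 := by
      have := hs.1
      linarith
    exact ((hc.hasDerivWithinAt_rightDeriv_of_mem_interior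
      (hint s ⟨hs.1.le, hs.2.le⟩)).const_mul K).div
        ((hasDerivAt_id s).add_const d).hasDerivWithinAt hs0
  · intro s hs
    have hs0 : 0 < s + d := by
      have := hs.1
      linarith
    have hx := h.le_rightDeriv_utility (zero_lt_one.trans hs.1)
    rw [mul_one, sub_div]
    refine sub_le_sub_right ?_ _
    rw [sq, mul_div_mul_right _ _ hs0.ne']
    gcongr

lemma integrableOn_regDensity_mul {q : ℝ} (h0 : 0 < q) (h1 : q < 1) {f : ℝ → ℝ}
    (hf : Measurable f) {C : ℝ} (hC : ∀ s ∈ Icc (1 : ℝ) 2, |f s| ≤ C) :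
    IntegrableOn (fun s => regDensity q s * f s) (Icc 1 2) := by
  have hd : IntegrableOn (regDensity q) (Icc 1 2) :=
    ((continuousOn_regDensity h0 h1).mono fun s hs => hs.1).integrableOn_compact isCompact_Icc
  refine Integrable.mul_bdd (c := C) hd hf.aestronglyMeasurable ?_
  filter_upwards [ae_restrict_mem measurableSet_Icc] with s hs using hC s hs

lemma lintegral_regDensity_mul {q : ℝ} (h0 : 0 < q) (h1 : q < 1) {f : ℝ → ℝ}
    (hf : Measurable f) {C : ℝ} (hC : ∀ s ∈ Icc (1 : ℝ) 2, |f s| ≤ C)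
    (hf0 : ∀ s ∈ Icc (1 : ℝ) 2, 0 ≤ f s) :
    ∫⁻ s in Ioc (1 : ℝ) 2, ENNReal.ofReal (regDensity q s) * ENNReal.ofReal (f s) =
      ENNReal.ofReal (∫ s in (1 : ℝ)..2, regDensity q s * f s) := by
  rw [intervalIntegral.integral_of_le one_le_two, ofReal_integral_eq_lintegral_ofReal]
  · exact lintegral_congr fun s => (ENNReal.ofReal_mul (regDensity_nonneg h0 h1 s)).symm
  · exact (integrableOn_regDensity_mul h0 h1 hf hC).mono_set Ioc_subset_Icc_self
  · filter_upwards [ae_restrict_mem measurableSet_Ioc] with s hs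
    exact mul_nonneg (regDensity_nonneg h0 h1 s) (hf0 s ⟨hs.1.le, hs.2⟩)

/-- For `d = 1/q - 2` and `K = 1/q - 1` the density is `K / (s + d)²` and the virtual value below
`2` is `-d`, so payment minus virtual value of the allocation, weighted by the density, is the
integrand of `SingleBuyer.integral_le`. The boundary terms are the utility at `2`, weighted by the
atom, and the utility at `1`. -/
lemma virtualBound_Freg {q : ℝ} (h0 : 0 < q) (h1 : q < 1) (hq : 1 / 2 ≤ q) :
    VirtualBound (Freg q h0 h1) (fun s => if s < 2 then 2 - 1 / q else 2) := by
  intro x p h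
  set a : ℝ := 2 - 1 / q with ha
  have hinv2 : 1 / q ≤ 2 := by rw [div_le_iff₀ h0]; linarith
  have hinv1 : 1 < 1 / q := by rw [lt_div_iff₀ h0]; linarith
  -- payments shifted so that a buyer of value 1 has utility 0
  set U : ℝ := 1 * x 1 - p 1 with hU
  have hU0 : 0 ≤ U := h.rational 1 zero_le_one
  have hm : Measurable fun s => p s + U := h.measurable_pay.add_const U
  -- Payments may be negative, but adding `U ≥ 0` makes them nonnegative on `[1, 2]` and only
  -- increases the left side; the `ENNReal` integrals then become ordinary ones.
  have hlow : ∀ s ∈ Icc (1 : ℝ) 2, 0 ≤ p s + U := by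
    intro s hs
    have e1 := h.truthful 1 zero_le_one s (zero_le_one.trans hs.1)
    have e2 := h.nonneg s (zero_le_one.trans hs.1)
    linarith
  have hhigh : ∀ s ∈ Icc (1 : ℝ) 2, p s + U ≤ 2 := by
    intro s hs
    have e0 := h.nonneg 1 zero_le_one
    have e1 := h.truthful s (zero_le_one.trans hs.1) 1 zero_le_one
    have e2 := h.le_one s (zero_le_one.trans hs.1)
    nlinarith [hs.1, hs.2]
  have hpC : ∀ s ∈ Icc (1 : ℝ) 2, |p s + U| ≤ 2 := fun s hs =>
    abs_le.2 ⟨by linarith [hlow s hs], hhigh s hs⟩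
  have hx0 : ∀ s ∈ Icc (1 : ℝ) 2, 0 ≤ x s := fun s hs => h.nonneg s (zero_le_one.trans hs.1)
  have hx1 : ∀ s ∈ Icc (1 : ℝ) 2, x s ≤ 1 := fun s hs => h.le_one s (zero_le_one.trans hs.1)
  have haxm : Measurable fun s => a * x s := h.measurable_alloc.const_mul a
  have hax0 : ∀ s ∈ Icc (1 : ℝ) 2, 0 ≤ a * x s := fun s hs =>
    mul_nonneg (by linarith) (hx0 s hs)
  have haxC : ∀ s ∈ Icc (1 : ℝ) 2, |a * x s| ≤ 2 := fun s hs =>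
    abs_le.2 ⟨by linarith [hax0 s hs], by nlinarith [hx0 s hs, hx1 s hs]⟩
  have hI2 : (2 : ℝ) ∈ Icc (1 : ℝ) 2 := by norm_num
  have hreal : (∫ s in (1 : ℝ)..2, regDensity q s * (p s + U)) + (1 - q) * (p 2 + U) ≤
      (∫ s in (1 : ℝ)..2, regDensity q s * (a * x s)) + (1 - q) * (2 * x 2) := by
    have i1 := integrableOn_regDensity_mul h0 h1 hm hpC
    have i2 := integrableOn_regDensity_mul h0 h1 haxm haxC
    have i3 := integrableOn_regDensity_mul h0 h1 (measurable_const (a := U)) (C := U)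
      fun s _ => (abs_of_nonneg hU0).le
    have heq : EqOn (fun s => regDensity q s * (p s + U) - regDensity q s * (a * x s) -
        regDensity q s * U) (fun s => (1 / q - 1) * x s / (s + (1 / q - 2)) -
          (1 / q - 1) * (s * x s - p s) / (s + (1 / q - 2)) ^ 2) (Icc 1 2) := by
      intro s hs
      have hd : s + (1 / q - 2) ≠ 0 := by linarith [hs.1]
      simp only [regDensity, ha]
      rw [show s - 2 + 1 / q = s + (1 / q - 2) by ring]
      generalize 1 / q = y at hd
      field_simp
      ring
    have key := h.integral_le (d := 1 / q - 2) (K := 1 / q - 1) (by linarith)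
      (((i1.sub i2).sub i3).congr_fun heq measurableSet_Icc) (by linarith)
    have hii : ∀ {f : ℝ → ℝ}, IntegrableOn f (Icc 1 2) → IntervalIntegrable f volume 1 2 :=
      fun hf => (intervalIntegrable_iff_integrableOn_Icc_of_le one_le_two).2 hf
    rw [← uIcc_of_le (one_le_two : (1 : ℝ) ≤ 2)] at heq
    rw [← intervalIntegral.integral_congr heq,
      intervalIntegral.integral_sub ((hii i1).sub (hii i2)) (hii i3),
      intervalIntegral.integral_sub (hii i1) (hii i2), intervalIntegral.integral_mul_const,
      integral_regDensity h0 h1 one_le_two, ← hU] at key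
    have e1 : (1 / q - 1) * (2 * x 2 - p 2) / (2 + (1 / q - 2)) = (1 - q) * (2 * x 2 - p 2) := by
      field_simp
      ring
    have e2 : (1 / q - 1) * U / (1 + (1 / q - 2)) = U := by
      have : 1 + (1 / q - 2) ≠ 0 := by linarith
      rw [div_eq_iff this]
      ring
    have e3 : (2 - 1) / (2 - 2 + 1 / q) * U = q * U := by
      field_simp
      ring
    rw [e1, e2, e3] at key
    linarith
  have hφm : Measurable fun s : ℝ => if s < 2 then a else 2 :=
    Measurable.ite measurableSet_Iio measurable_const measurable_const
  rw [lintegral_Freg h0 h1 _ h.measurable_pay.ennreal_ofReal,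
    lintegral_Freg h0 h1 (fun s => ENNReal.ofReal ((if s < 2 then a else 2) * x s))
      (hφm.mul h.measurable_alloc).ennreal_ofReal]
  calc _ ≤ (∫⁻ s in Ioc (1 : ℝ) 2, ENNReal.ofReal (regDensity q s) * ENNReal.ofReal (p s + U)) +
        ENNReal.ofReal (1 - q) * ENNReal.ofReal (p 2 + U) := by
        gcongr <;> linarith
    _ = ENNReal.ofReal ((∫ s in (1 : ℝ)..2, regDensity q s * (p s + U)) +
          (1 - q) * (p 2 + U)) := by
        rw [lintegral_regDensity_mul h0 h1 hm hpC hlow, ← ENNReal.ofReal_mul (by linarith),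
          ← ENNReal.ofReal_add]
        · exact intervalIntegral.integral_nonneg one_le_two fun s hs =>
            mul_nonneg (regDensity_nonneg h0 h1 s) (hlow s hs)
        · exact mul_nonneg (by linarith) (hlow 2 hI2)
    _ ≤ ENNReal.ofReal ((∫ s in (1 : ℝ)..2, regDensity q s * (a * x s)) +
          (1 - q) * (2 * x 2)) := ENNReal.ofReal_le_ofReal hreal
    _ = (∫⁻ s in Ioc (1 : ℝ) 2, ENNReal.ofReal (regDensity q s) * ENNReal.ofReal (a * x s)) +
          ENNReal.ofReal (1 - q) * ENNReal.ofReal (2 * x 2) := by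
        rw [lintegral_regDensity_mul h0 h1 haxm haxC hax0, ← ENNReal.ofReal_mul (by linarith),
          ← ENNReal.ofReal_add]
        · exact intervalIntegral.integral_nonneg one_le_two fun s hs =>
            mul_nonneg (regDensity_nonneg h0 h1 s) (hax0 s hs)
        · exact mul_nonneg (by linarith) (mul_nonneg zero_le_two (hx0 2 hI2))
    _ = _ := by
        rw [if_neg (lt_irrefl _)]
        congr 1
        refine setLIntegral_congr_fun_ae measurableSet_Ioc ?_
        -- The virtual value jumps at `2`, which is null for the density part; the atom there is the
        -- separate term.
        filter_upwards [Measure.ae_ne volume (2 : ℝ)] with s hs2 hs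
        rw [if_pos (lt_of_le_of_ne hs.2 hs2)]

/-! ### The optimal revenue and the second-price revenue for `Freg` -/

lemma null_Iio_zero_of_ae_Icc {μ : Measure ℝ} (h : ∀ᵐ s ∂μ, s ∈ Icc (1 : ℝ) 2) :
    μ (Iio 0) = 0 := by
  rw [ae_iff] at h
  refine measure_mono_null (fun s hs => ?_) h
  exact fun hc => absurd hc.1 (by linarith [mem_Iio.1 hs])

lemma opt_Freg_le {q : ℝ} (h0 : 0 < q) (h1 : q < 1) (hq : 1 / 2 ≤ q) :
    opt (fun _ : Fin 3 => Freg q h0 h1) ≤ ((2 - q ^ 2 : ℝ) : EReal) := by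
  have hinv2 : 1 / q ≤ 2 := by rw [div_le_iff₀ h0]; linarith
  have hinv0 : 0 < 1 / q := by positivity
  refine (opt_le_of_two_level (fun _ => null_Iio_zero_of_ae_Icc (Freg_ae_mem_Icc h0 h1))
    (φ := fun _ s => if s < 2 then 2 - 1 / q else 2) (a := 2 - 1 / q) (b := q ^ 3)
    ?_ ?_ (fun _ => virtualBound_Freg h0 h1 hq) (by linarith) ?_ ?_ ?_).trans ?_
  · exact fun _ => Measurable.ite measurableSet_Iio measurable_const measurable_const
  · intro _ s
    split_ifs <;> linarith
  · intro _ s hs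
    simp [hs]
  · intro _ s
    split_ifs <;> linarith
  · rw [Fin.prod_univ_three, Freg_Iio_two]
    ring
  · refine EReal.coe_le_coe_iff.2 (le_of_eq ?_)
    field_simp
    ring

/-- The integrand is `S² (3 - 2S)`, the tail of the median of three draws when a single draw from
`Freg` has tail `S` on `[1, 2)`. -/
lemma integral_reg_tail {q : ℝ} (h0 : 0 < q) (h1 : q < 1) :
    IntervalIntegrable (fun t => ((1 / q - 1) / (t - 2 + 1 / q)) ^ 2 *
      (3 - 2 * ((1 / q - 1) / (t - 2 + 1 / q)))) volume 1 2 ∧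
    ∫ t in (1 : ℝ)..2, ((1 / q - 1) / (t - 2 + 1 / q)) ^ 2 *
      (3 - 2 * ((1 / q - 1) / (t - 2 + 1 / q))) = 1 - q ^ 2 := by
  have hpos : ∀ t ∈ uIcc (1 : ℝ) 2, 0 < t - 2 + 1 / q := fun t ht => by
    rw [uIcc_of_le one_le_two] at ht
    exact regCDF_den_pos h0 h1 ht.1
  have hi : IntervalIntegrable (fun t => ((1 / q - 1) / (t - 2 + 1 / q)) ^ 2 *
      (3 - 2 * ((1 / q - 1) / (t - 2 + 1 / q)))) volume 1 2 := by
    have hc : ContinuousOn (fun t => (1 / q - 1) / (t - 2 + 1 / q)) (uIcc 1 2) :=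
      ContinuousOn.div (by fun_prop) (by fun_prop) fun t ht => (hpos t ht).ne'
    exact ((hc.pow 2).mul (continuousOn_const.sub (continuousOn_const.mul hc))).intervalIntegrable
  refine ⟨hi, ?_⟩
  rw [intervalIntegral.integral_eq_sub_of_hasDerivAt
    (f := fun t => -3 * (1 / q - 1) ^ 2 * (t - 2 + 1 / q)⁻¹ +
      (1 / q - 1) ^ 3 * ((t - 2 + 1 / q)⁻¹) ^ 2) _ hi]
  · have : 1 - 2 + 1 / q ≠ 0 := (hpos 1 (by simp)).ne'
    have h1q : 1 - q ≠ 0 := by linarith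
    have e : 1 - 2 + 1 / q = (1 - q) / q := by field_simp; ring
    have e' : 1 / q - 1 = (1 - q) / q := by field_simp
    simp only [e, e']
    field_simp
    ring
  · intro t ht
    have hd := (hpos t ht).ne'
    have hu : HasDerivAt (fun t => (t - 2 + 1 / q)⁻¹) (-1 / (t - 2 + 1 / q) ^ 2) t :=
      (((hasDerivAt_id t).sub_const 2).add_const (1 / q)).inv hd
    refine ((hu.const_mul (-3 * (1 / q - 1) ^ 2)).add
      ((hu.pow 2).const_mul ((1 / q - 1) ^ 3))).congr_deriv ?_
    generalize 1 / q = y at hd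
    rw [Nat.add_one_sub_one, pow_one]
    field_simp
    ring

lemma le_revenue_secondPrice_Freg {q : ℝ} (h0 : 0 < q) (h1 : q < 1) :
    ((2 - q ^ 2 : ℝ) : EReal) ≤ revenue (secondPrice 3 0) (fun _ : Fin 3 => Freg q h0 h1) := by
  rw [revenue_secondPrice fun _ => null_Iio_zero_of_ae_Icc (Freg_ae_mem_Icc h0 h1)]
  have hG : ∀ t, orderStatLaw 2 (fun _ : Fin 3 => Freg q h0 h1) (Ioi t) =
      ENNReal.ofReal ((1 - regCDF q t) ^ 2 * (3 - 2 * (1 - regCDF q t))) := by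
    intro t
    rw [orderStatLaw_Ioi]
    exact pi_twoIn_same _ measurableSet_Ioi (by linarith [regCDF_le_one h0 h1 t])
      (by linarith [regCDF_nonneg h0 h1 t]) (Freg_Ioi h0 h1 t)
  have hnn : 0 ≤ᵐ[orderStatLaw 2 (fun _ : Fin 3 => Freg q h0 h1)] fun x => x := by
    rw [orderStatLaw, kthLargest_two_eq_median]
    refine (ae_map_iff measurable_median.aemeasurable measurableSet_Ici).2 ?_
    filter_upwards [ae_pi_nonneg
      fun _ : Fin 3 => null_Iio_zero_of_ae_Icc (Freg_ae_mem_Icc h0 h1)] with v hv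
    exact nonneg_median hv
  obtain ⟨hi, hint⟩ := integral_reg_tail h0 h1
  have hq2 : 0 ≤ 1 - q ^ 2 := by nlinarith
  have hle : ENNReal.ofReal (2 - q ^ 2) ≤
      ∫⁻ x, ENNReal.ofReal x ∂orderStatLaw 2 (fun _ : Fin 3 => Freg q h0 h1) := by
    -- Layer cake: the tail is `1` on `(0, 1)`, contributing `1`, and `integral_reg_tail` gives `1 -
    -- q²` on `(1, 2]`.
    rw [lintegral_eq_lintegral_meas_lt _ hnn measurable_id.aemeasurable]
    calc ENNReal.ofReal (2 - q ^ 2) = ENNReal.ofReal 1 + ENNReal.ofReal (1 - q ^ 2) := by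
          rw [← ENNReal.ofReal_add zero_le_one hq2]
          congr 1
          ring
      _ = (∫⁻ t in Ioo (0 : ℝ) 1, orderStatLaw 2 (fun _ : Fin 3 => Freg q h0 h1) (Ioi t)) +
          ∫⁻ t in Ioc (1 : ℝ) 2, orderStatLaw 2 (fun _ : Fin 3 => Freg q h0 h1) (Ioi t) := by
          congr 1
          · rw [setLIntegral_congr_fun (g := fun _ => 1) measurableSet_Ioo]
            · simp
            · intro t ht
              dsimp only
              rw [hG, regCDF, if_pos ht.2]
              norm_num
          · rw [← hint, intervalIntegral.integral_of_le one_le_two,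
              ofReal_integral_eq_lintegral_ofReal
                ((intervalIntegrable_iff_integrableOn_Ioc_of_le one_le_two).1 hi)]
            · refine setLIntegral_congr_fun_ae measurableSet_Ioc ?_
              filter_upwards [Measure.ae_ne volume (2 : ℝ)] with t ht2 ht
              have hd := (regCDF_den_pos h0 h1 ht.1.le).ne'
              rw [hG, regCDF, if_neg (not_lt.2 ht.1.le), if_pos (lt_of_le_of_ne ht.2 ht2)]
              have e : (1 / q - 1) / (t - 2 + 1 / q) = 1 - (t - 1) / (t - 2 + 1 / q) := by
                rw [eq_sub_iff_add_eq, ← add_div, div_eq_one_iff_eq hd]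
                ring
              rw [e]
            · filter_upwards [ae_restrict_mem measurableSet_Ioc] with t ht
              have hd := regCDF_den_pos h0 h1 ht.1.le
              have : (1 / q - 1) / (t - 2 + 1 / q) ≤ 1 := by
                rw [div_le_one hd]
                linarith [ht.1]
              exact mul_nonneg (sq_nonneg _) (by linarith)
      _ ≤ ∫⁻ t in Ioi (0 : ℝ), orderStatLaw 2 (fun _ : Fin 3 => Freg q h0 h1) (Ioi t) := by
          rw [← lintegral_union measurableSet_Ioc]
          · refine lintegral_mono_set ?_
            rintro t (ht | ht)
            · exact ht.1
            · exact zero_lt_one.trans ht.1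
          · rw [Set.disjoint_left]
            intro t ht ht'
            linarith [ht.2, ht'.1]
  have := EReal.coe_ennreal_le_coe_ennreal_iff.2 hle
  rwa [EReal.coe_ennreal_ofReal, max_eq_left (by linarith)] at this

/-! ### Myerson's auction is admissible -/

section Admissible

variable {n : ℕ} {μ : Measure ℝ} {π : Equiv.Perm (Fin n)}

lemma WinsMyerson.unique {v : Fin n → ℝ} {i j : Fin n} (hi : WinsMyerson μ π v i)
    (hj : WinsMyerson μ π v j) : i = j := by
  by_contra hij
  rcases hi.2 j (Ne.symm hij) with h | h <;> rcases hj.2 i hij with h' | h'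
  · exact lt_asymm h h'
  · exact h.ne h'.1.symm
  · exact h'.ne h.1.symm
  · exact lt_asymm h.2 h'.2

lemma WinsMyerson.mono (hμ : Monotone (virtualValue μ)) {v : Fin n → ℝ} {i : Fin n} {z z' : ℝ}
    (hz : z ≤ z') (h : WinsMyerson μ π (Function.update v i z) i) :
    WinsMyerson μ π (Function.update v i z') i := by
  obtain ⟨h1, h2⟩ := h
  simp only [Function.update_self] at h1 h2
  refine ⟨by simpa using h1.trans (hμ hz), fun j hj => ?_⟩
  have h3 := h2 j hj
  simp only [Function.update_self, Function.update_of_ne hj] at h3 ⊢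
  rcases h3 with h | ⟨h, h'⟩
  · exact Or.inl (h.trans_le (hμ hz))
  · rw [h]
    exact (lt_or_eq_of_le (hμ hz)).imp id fun h => ⟨h, h'⟩

lemma minWinningBid_update (v : Fin n → ℝ) (i : Fin n) (z : ℝ) :
    minWinningBid μ π (Function.update v i z) i = minWinningBid μ π v i := by
  simp [minWinningBid]

lemma minWinningBid_le {v : Fin n → ℝ} {i : Fin n} (hv : 0 ≤ v i) (h : WinsMyerson μ π v i) :
    minWinningBid μ π v i ≤ v i :=
  csInf_le ⟨0, fun _ hz => hz.1⟩ ⟨hv, by simpa using h⟩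

/-- Some winning bid `z` has to exist: otherwise the infimum is over the empty set and takes the
default value `0`. -/
lemma le_minWinningBid (hμ : Monotone (virtualValue μ)) {v : Fin n → ℝ} {i : Fin n} {z : ℝ}
    (hz : 0 ≤ z) (hwin : WinsMyerson μ π (Function.update v i z) i)
    (h : ¬ WinsMyerson μ π v i) : v i ≤ minWinningBid μ π v i := by
  refine le_csInf ⟨z, hz, hwin⟩ fun y hy => ?_
  by_contra hlt
  exact h (by simpa using hy.2.mono hμ (not_le.1 hlt).le)

lemma measurableSet_winsMyerson (hμ : Monotone (virtualValue μ)) (i : Fin n) :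
    MeasurableSet {v | WinsMyerson μ π v i} := by
  have hm : ∀ j : Fin n, Measurable fun v : Fin n → ℝ => virtualValue μ (v j) := fun j =>
    hμ.measurable.comp (measurable_pi_apply j)
  have h : {v | WinsMyerson μ π v i} = {v | 0 ≤ virtualValue μ (v i)} ∩
      ⋂ j, ⋂ (_ : j ≠ i), ({v | virtualValue μ (v j) < virtualValue μ (v i)} ∪
        ({v | virtualValue μ (v j) = virtualValue μ (v i)} ∩ {_v | π i < π j})) := by
    ext v
    simp [WinsMyerson]
  rw [h]
  refine (measurableSet_le measurable_const (hm i)).inter ?_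
  refine MeasurableSet.iInter fun j => MeasurableSet.iInter fun _ => ?_
  exact (measurableSet_lt (hm j) (hm i)).union
    ((measurableSet_eq_fun (hm j) (hm i)).inter (MeasurableSet.const _))

lemma measurable_minWinningBid (hμ : Monotone (virtualValue μ)) (i : Fin n) :
    Measurable fun v => minWinningBid μ π v i := by
  have hW : ∀ z : ℝ, MeasurableSet {v : Fin n → ℝ | WinsMyerson μ π (Function.update v i z) i} :=
    fun z => measurable_update_left (measurableSet_winsMyerson hμ i)
  refine measurable_of_Iio fun a => ?_
  rcases le_or_gt a 0 with ha | ha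
  · have : (fun v => minWinningBid μ π v i) ⁻¹' Iio a = ∅ := by
      refine eq_empty_of_forall_notMem fun v hv => ?_
      have : 0 ≤ minWinningBid μ π v i := Real.sInf_nonneg fun z hz => hz.1
      exact absurd (mem_Iio.1 hv) (not_lt.2 (ha.trans this))
    rw [this]
    exact MeasurableSet.empty
  -- Winning is upward closed in the own bid, so countably many bids decide: either some rational
  -- bid below `a` wins, or no natural number wins and the infimum of the empty set is `0 < a`.
  · have : (fun v => minWinningBid μ π v i) ⁻¹' Iio a =
        (⋃ z : ℚ, ⋃ (_ : 0 ≤ (z : ℝ) ∧ (z : ℝ) < a),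
          {v | WinsMyerson μ π (Function.update v i z) i}) ∪
        ⋂ m : ℕ, {v | WinsMyerson μ π (Function.update v i m) i}ᶜ := by
      ext v
      simp only [mem_preimage, mem_Iio, mem_union, mem_iUnion, mem_iInter, mem_compl_iff,
        mem_ofPred_eq, exists_prop]
      constructor
      · intro h
        by_cases hne : {z : ℝ | 0 ≤ z ∧ WinsMyerson μ π (Function.update v i z) i}.Nonempty
        · obtain ⟨y, hy, hya⟩ := exists_lt_of_csInf_lt hne h
          obtain ⟨z, hyz, hza⟩ := exists_rat_btwn hya
          exact Or.inl ⟨z, ⟨hy.1.trans hyz.le, hza⟩, hy.2.mono hμ hyz.le⟩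
        · exact Or.inr fun m hm => hne ⟨m, Nat.cast_nonneg m, hm⟩
      · rintro (⟨z, ⟨hz0, hza⟩, hz⟩ | h)
        · exact lt_of_le_of_lt (csInf_le ⟨0, fun _ hy => hy.1⟩ ⟨hz0, hz⟩) hza
        · have : {z : ℝ | 0 ≤ z ∧ WinsMyerson μ π (Function.update v i z) i} = ∅ := by
            refine eq_empty_of_forall_notMem fun z hz => ?_
            obtain ⟨m, hm⟩ := exists_nat_ge z
            exact h m (hz.2.mono hμ hm)
          rw [minWinningBid, this, Real.sInf_empty]
          exact ha
    rw [this]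
    refine MeasurableSet.union ?_ (MeasurableSet.iInter fun m => (hW m).compl)
    exact MeasurableSet.iUnion fun z => MeasurableSet.iUnion fun _ => hW z

/-- For each fixed priority order this is a threshold auction whose threshold ignores the own bid;
the constraints are linear in the mechanism and survive averaging over orders. -/
lemma myerson_admissible (hμ : Monotone (virtualValue μ)) {w : Equiv.Perm (Fin n) → ℝ}
    (hw : w ∈ stdSimplex ℝ (Equiv.Perm (Fin n))) : (myerson μ w).Admissible := by
  classical
  have hutil : ∀ (y : ℝ) (v : Fin n → ℝ) (i : Fin n),
      y * (myerson μ w).alloc v i - (myerson μ w).pay v i =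
        ∑ π, w π * if WinsMyerson μ π v i then y - minWinningBid μ π v i else 0 := by
    intro y v i
    simp only [myerson, Finset.mul_sum, ← Finset.sum_sub_distrib]
    refine Finset.sum_congr rfl fun π _ => ?_
    split_ifs <;> ring
  constructor
  · intro v _ i
    exact Finset.sum_nonneg fun π _ => mul_nonneg (hw.1 π) (by split_ifs <;> norm_num)
  · intro v _
    simp only [myerson]
    rw [Finset.sum_comm]
    refine (Finset.sum_le_sum fun π _ => ?_).trans hw.2.le
    rw [← Finset.mul_sum]
    refine mul_le_of_le_one_right (hw.1 π) ?_
    by_cases h : ∃ i, WinsMyerson μ π v i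
    · obtain ⟨i, hi⟩ := h
      rw [Finset.sum_eq_single i, if_pos hi]
      · exact fun j _ hji => if_neg fun hj => hji (hj.unique hi)
      · simp
    · push Not at h
      simp [h]
  · intro v hv i z hz
    rw [hutil, hutil]
    refine Finset.sum_le_sum fun π _ => mul_le_mul_of_nonneg_left ?_ (hw.1 π)
    rw [minWinningBid_update]
    by_cases h : WinsMyerson μ π v i
    · rw [if_pos h]
      split_ifs
      · exact le_rfl
      · linarith [minWinningBid_le (hv i) h]
    · rw [if_neg h]
      split_ifs with h'
      · linarith [le_minWinningBid hμ hz h' h]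
      · exact le_rfl
  · intro v hv i
    rw [hutil]
    refine Finset.sum_nonneg fun π _ => mul_nonneg (hw.1 π) ?_
    split_ifs with h
    · linarith [minWinningBid_le (hv i) h]
    · exact le_rfl
  · refine measurable_pi_lambda _ fun i => Finset.measurable_sum _ fun π _ => ?_
    exact (Measurable.ite (measurableSet_winsMyerson hμ i) measurable_const
      measurable_const).const_mul _
  · refine measurable_pi_lambda _ fun i => Finset.measurable_sum _ fun π _ => ?_
    exact (Measurable.ite (measurableSet_winsMyerson hμ i) (measurable_minWinningBid hμ i)
      measurable_const).const_mul _

end Admissible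

/-! ### Virtual values of `Freg` -/

section VirtualValue

variable {q : ℝ} (h0 : 0 < q) (h1 : q < 1)

lemma coe_cdf_Freg : (ProbabilityTheory.cdf (Freg q h0 h1) : ℝ → ℝ) = regCDF q :=
  funext (cdf_Freg_apply h0 h1)

lemma virtualValue_Freg_of_lt_one {v : ℝ} (hv : v < 1) :
    virtualValue (Freg q h0 h1) v = ⊥ := by
  have hd : derivWithin (regCDF q) (Ici v) v = 0 := by
    have : regCDF q =ᶠ[nhdsWithin v (Ici v)] fun _ => 0 := by
      filter_upwards [mem_nhdsWithin_of_mem_nhds (Iio_mem_nhds hv)] with y hy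
      simp [regCDF, mem_Iio.1 hy]
    rw [this.derivWithin_eq (by simp [regCDF, hv])]
    simp
  have hv' : regCDF q v = 0 := by simp [regCDF, hv]
  -- Zero density under positive tail: the quotient in `ENNReal` is `⊤`, so the difference is `⊥`.
  rw [virtualValue, coe_cdf_Freg, hd, hv']
  simp

lemma virtualValue_Freg_of_mem {v : ℝ} (hv : 1 ≤ v) (hv2 : v < 2) :
    virtualValue (Freg q h0 h1) v = ((2 - 1 / q : ℝ) : EReal) := by
  have hden := regCDF_den_pos h0 h1 hv
  have hinv1 : 1 < 1 / q := by rw [lt_div_iff₀ h0]; linarith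
  have hd : derivWithin (regCDF q) (Ici v) v = regDensity q v := by
    have : HasDerivWithinAt (regCDF q) (regDensity q v) (Ici v) v := by
      refine (hasDerivAt_regCDF_formula h0 h1 hv).hasDerivWithinAt.congr_of_eventuallyEq ?_ ?_
      · filter_upwards [self_mem_nhdsWithin, mem_nhdsWithin_of_mem_nhds (Iio_mem_nhds hv2)]
          with y h h'
        simp [regCDF, not_lt.2 (hv.trans h), mem_Iio.1 h']
      · simp [regCDF, not_lt.2 hv, hv2]
    exact this.derivWithin (uniqueDiffOn_Ici v v self_mem_Ici)
  have hpos : 0 < regDensity q v := div_pos (by linarith) (by positivity)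
  rw [virtualValue, coe_cdf_Freg, hd, ← ENNReal.ofReal_div_of_pos hpos, EReal.coe_ennreal_ofReal,
    max_eq_left (div_nonneg (by linarith [regCDF_le_one h0 h1 v]) hpos.le), ← EReal.coe_sub]
  congr 1
  rw [regCDF, if_neg (not_lt.2 hv), if_pos hv2, regDensity]
  have : 1 / q - 1 ≠ 0 := by linarith
  have e : 1 - (v - 1) / (v - 2 + 1 / q) = (1 / q - 1) / (v - 2 + 1 / q) := by
    rw [eq_div_iff hden.ne', sub_mul, div_mul_cancel₀ _ hden.ne']
    ring
  rw [e]
  generalize 1 / q = y at *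
  field_simp
  ring

lemma virtualValue_Freg_of_two_le {v : ℝ} (hv : 2 ≤ v) :
    virtualValue (Freg q h0 h1) v = (v : EReal) := by
  have hv' : regCDF q v = 1 := by
    rw [regCDF, if_neg (by linarith), if_neg (by linarith)]
  -- The tail vanishes, so the quotient is `0` whatever the derivative is, because `0 / 0 = 0` in
  -- `ENNReal`.
  rw [virtualValue, coe_cdf_Freg, hv']
  simp

lemma monotone_virtualValue_Freg : Monotone (virtualValue (Freg q h0 h1)) := by
  intro x y hxy
  have hinv0 : 0 < 1 / q := by positivity
  rcases lt_or_ge x 1 with hx | hx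
  · rw [virtualValue_Freg_of_lt_one h0 h1 hx]
    exact bot_le
  rcases lt_or_ge y 2 with hy | hy
  · rw [virtualValue_Freg_of_mem h0 h1 hx (by linarith),
      virtualValue_Freg_of_mem h0 h1 (by linarith) hy]
  rw [virtualValue_Freg_of_two_le h0 h1 hy]
  rcases lt_or_ge x 2 with hx2 | hx2
  · rw [virtualValue_Freg_of_mem h0 h1 hx hx2]
    exact EReal.coe_le_coe_iff.2 (by linarith)
  · rw [virtualValue_Freg_of_two_le h0 h1 hx2]
    exact EReal.coe_le_coe_iff.2 hxy

lemma virtualValue_Freg_lt_two {v : ℝ} (hv : v < 2) :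
    virtualValue (Freg q h0 h1) v < ((2 : ℝ) : EReal) := by
  rcases lt_or_ge v 1 with hv1 | hv1
  · rw [virtualValue_Freg_of_lt_one h0 h1 hv1]
    exact EReal.bot_lt_coe 2
  · rw [virtualValue_Freg_of_mem h0 h1 hv1 hv]
    exact EReal.coe_lt_coe_iff.2 (by linarith [one_div_pos.2 h0])

end VirtualValue

/-! ### The revenue of Myerson's auction -/

section TotalPayment

variable {q : ℝ} (h0 : 0 < q) (h1 : q < 1) {n : ℕ} {π : Equiv.Perm (Fin n)} {v : Fin n → ℝ}
  {top : Fin n}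

/-- A bid of `1` already joins the pool `[1, 2)`, whose virtual value is nonnegative as `q ≥ 1/2`,
and `top` wins ties in it; lower bids have virtual value `⊥`. -/
lemma minWinningBid_top_eq_one (hq : 1 / 2 ≤ q) (hπ : ∀ j, j ≠ top → 1 ≤ v j → π top < π j)
    (hlow : ∀ j, j ≠ top → v j < 2) :
    minWinningBid (Freg q h0 h1) π v top = 1 := by
  have hinv2 : 1 / q ≤ 2 := by rw [div_le_iff₀ h0]; linarith
  have ha : virtualValue (Freg q h0 h1) 1 = ((2 - 1 / q : ℝ) : EReal) :=
    virtualValue_Freg_of_mem h0 h1 le_rfl one_lt_two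
  have hset : {z : ℝ | 0 ≤ z ∧ WinsMyerson (Freg q h0 h1) π (Function.update v top z) top} =
      Ici 1 := by
    ext z
    refine ⟨fun hz => ?_, fun hz => ⟨zero_le_one.trans hz, ?_⟩⟩
    · by_contra hlt
      have := hz.2.1
      rw [Function.update_self, virtualValue_Freg_of_lt_one h0 h1 (not_le.1 hlt)] at this
      exact absurd this (not_le.2 EReal.bot_lt_zero)
    · have hmono := monotone_virtualValue_Freg h0 h1 (mem_Ici.1 hz)
      rw [ha] at hmono
      refine ⟨?_, fun j hj => ?_⟩
      · rw [Function.update_self]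
        refine le_trans ?_ hmono
        exact EReal.coe_le_coe_iff.2 (by linarith)
      · rw [Function.update_self, Function.update_of_ne hj]
        rcases lt_or_ge (v j) 1 with h | h
        · rw [virtualValue_Freg_of_lt_one h0 h1 h]
          exact Or.inl ((EReal.bot_lt_coe _).trans_le hmono)
        · rw [virtualValue_Freg_of_mem h0 h1 h (hlow j hj)]
          exact (lt_or_eq_of_le hmono).imp id fun h' => ⟨h', hπ j hj h⟩
  rw [minWinningBid, hset, csInf_Ici]

/-- With a bid below `2`, buyer `top` loses to the other bid of `2`, and any other buyer at best
ties with `top` and then loses on priority. -/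
lemma minWinningBid_eq_two (htop : 1 ≤ v top) (hπ : ∀ j, j ≠ top → 1 ≤ v j → π top < π j)
    (hhigh : ∃ j, j ≠ top ∧ v j = 2) {i : Fin n} (hi : v i = 2)
    (hwin : WinsMyerson (Freg q h0 h1) π v i) :
    minWinningBid (Freg q h0 h1) π v i = 2 := by
  refine IsLeast.csInf_eq ⟨⟨zero_le_two, by rw [← hi]; simpa using hwin⟩, fun z hz => ?_⟩
  by_contra hlt
  rw [not_le] at hlt
  obtain ⟨-, hz1, hz2⟩ := hz
  have hz3 := virtualValue_Freg_lt_two h0 h1 hlt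
  rw [Function.update_self] at hz1
  by_cases hit : i = top
  · obtain ⟨j, hj, hj2⟩ := hhigh
    have := hz2 j (hit ▸ hj)
    rw [Function.update_self, Function.update_of_ne (hit ▸ hj), hj2,
      virtualValue_Freg_of_two_le h0 h1 le_rfl] at this
    rcases this with h | h
    · exact lt_asymm h hz3
    · exact hz3.ne h.1.symm
  · have hz1' : 1 ≤ z := by
      by_contra hc
      rw [virtualValue_Freg_of_lt_one h0 h1 (not_le.1 hc)] at hz1
      exact absurd hz1 (not_le.2 EReal.bot_lt_zero)
    have := hz2 top (Ne.symm hit)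
    rw [Function.update_self, Function.update_of_ne (Ne.symm hit)] at this
    have hle : virtualValue (Freg q h0 h1) z ≤ virtualValue (Freg q h0 h1) (v top) := by
      rw [virtualValue_Freg_of_mem h0 h1 hz1' hlt,
        ← virtualValue_Freg_of_mem h0 h1 le_rfl one_lt_two]
      exact monotone_virtualValue_Freg h0 h1 htop
    rcases this with h | h
    · exact absurd h (not_lt.2 hle)
    · exact lt_asymm h.2 (hπ i hit (by rw [hi]; norm_num))

lemma exists_winner_of_eq_two (hle : ∀ j, v j ≤ 2) (hhigh : ∃ j, v j = 2) :
    ∃ i, v i = 2 ∧ WinsMyerson (Freg q h0 h1) π v i := by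
  classical
  obtain ⟨j, hj⟩ := hhigh
  obtain ⟨i, hi, hmin⟩ := Finset.exists_min_image (Finset.univ.filter fun j => v j = 2) π
    ⟨j, by simpa using hj⟩
  simp only [Finset.mem_filter, Finset.mem_univ, true_and] at hi hmin
  have hvi : virtualValue (Freg q h0 h1) (v i) = ((2 : ℝ) : EReal) := by
    rw [hi, virtualValue_Freg_of_two_le h0 h1 le_rfl]
  refine ⟨i, hi, ?_, fun k hk => ?_⟩
  · rw [hvi]
    exact EReal.coe_nonneg.2 zero_le_two
  · rcases lt_or_eq_of_le (hle k) with h | h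
    · rw [hvi]
      exact Or.inl (virtualValue_Freg_lt_two h0 h1 h)
    · refine Or.inr ⟨by rw [h, hi], lt_of_le_of_ne (hmin k h) fun he => hk ?_⟩
      exact (π.injective he).symm

open Classical in
/-- If the buyers bidding at least `1` bid at most `2` and `top` has priority among them, the winner
pays `1` when all other bids are below `2`, and pays `2` otherwise. -/
lemma sum_myerson_pay (hq : 1 / 2 ≤ q) (htop : 1 ≤ v top) (hle : ∀ j, v j ≤ 2)
    (hπ : ∀ j, j ≠ top → 1 ≤ v j → π top < π j) :
    ∑ i, (if WinsMyerson (Freg q h0 h1) π v i then minWinningBid (Freg q h0 h1) π v i else 0) =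
      if ∀ j, j ≠ top → v j < 2 then 1 else 2 := by
  have hsum : ∀ i, WinsMyerson (Freg q h0 h1) π v i →
      ∑ i, (if WinsMyerson (Freg q h0 h1) π v i then minWinningBid (Freg q h0 h1) π v i else 0) =
        minWinningBid (Freg q h0 h1) π v i := by
    intro i hi
    rw [Finset.sum_eq_single i, if_pos hi]
    · exact fun j _ hji => if_neg fun hj => hji (hj.unique hi)
    · simp
  by_cases hlow : ∀ j, j ≠ top → v j < 2
  · have hmin := minWinningBid_top_eq_one h0 h1 hq hπ hlow
    rw [if_pos hlow, hsum top, hmin]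
    -- The threshold of `top` is `1`, so losing would force a bid of exactly `1`, and there the pool
    -- tie goes to `top`.
    by_contra hlose
    have hwin : WinsMyerson (Freg q h0 h1) π (Function.update v top 2) top := by
      refine ⟨?_, fun j hj => Or.inl ?_⟩
      · rw [Function.update_self, virtualValue_Freg_of_two_le h0 h1 le_rfl]
        exact EReal.coe_nonneg.2 zero_le_two
      · rw [Function.update_self, Function.update_of_ne hj,
          virtualValue_Freg_of_two_le h0 h1 le_rfl]
        exact virtualValue_Freg_lt_two h0 h1 (hlow j hj)
    have h1' : v top = 1 := le_antisymm
      (hmin ▸ le_minWinningBid (monotone_virtualValue_Freg h0 h1) zero_le_two hwin hlose) htop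
    refine hlose ⟨?_, fun j hj => ?_⟩
    · rw [h1', virtualValue_Freg_of_mem h0 h1 le_rfl one_lt_two]
      exact EReal.coe_nonneg.2 (by
        have : 1 / q ≤ 2 := by rw [div_le_iff₀ h0]; linarith
        linarith)
    · rw [h1', virtualValue_Freg_of_mem h0 h1 le_rfl one_lt_two]
      rcases lt_or_ge (v j) 1 with h | h
      · rw [virtualValue_Freg_of_lt_one h0 h1 h]
        exact Or.inl (EReal.bot_lt_coe _)
      · exact Or.inr ⟨virtualValue_Freg_of_mem h0 h1 h (hlow j hj), hπ j hj h⟩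
  · rw [if_neg hlow]
    push Not at hlow
    obtain ⟨j, hj, hj2⟩ := hlow
    have hhigh := le_antisymm (hle j) hj2
    obtain ⟨i, hi, hwin⟩ := exists_winner_of_eq_two h0 h1 (π := π) hle ⟨j, hhigh⟩
    rw [hsum i hwin, minWinningBid_eq_two h0 h1 htop hπ ⟨j, hj, hhigh⟩ hi hwin]

end TotalPayment

lemma revenue_eq_integral {n : ℕ} {F : Fin n → Measure ℝ} {M : Mechanism n}
    {g : (Fin n → ℝ) → ℝ} (hg : Integrable g (Measure.pi F)) (hg0 : ∀ v, 0 ≤ g v)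
    (h : (fun v => ∑ i, M.pay v i) =ᵐ[Measure.pi F] g) :
    revenue M F = ((∫ v, g v ∂Measure.pi F : ℝ) : EReal) := by
  have e1 : ∫⁻ v, ENNReal.ofReal (∑ i, M.pay v i) ∂(Measure.pi F) =
      ENNReal.ofReal (∫ v, g v ∂Measure.pi F) := by
    rw [ofReal_integral_eq_lintegral_ofReal hg (Filter.Eventually.of_forall hg0)]
    refine lintegral_congr_ae ?_
    filter_upwards [h] with v hv
    rw [hv]
  have e2 : ∫⁻ v, ENNReal.ofReal (-∑ i, M.pay v i) ∂(Measure.pi F) = 0 := by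
    rw [← lintegral_zero (μ := Measure.pi F)]
    refine lintegral_congr_ae ?_
    filter_upwards [h] with v hv
    rw [hv, ENNReal.ofReal_of_nonpos (by linarith [hg0 v])]
  rw [revenue, e1, e2, EReal.coe_ennreal_ofReal, max_eq_left (integral_nonneg hg0)]
  simp

/-- For each order the payment is `2` minus the indicator that all buyers except `top π` bid below
`2`. As `b` does not depend on the order, the weights drop out. -/
lemma revenue_myerson {q : ℝ} (h0 : 0 < q) (h1 : q < 1) (hq : 1 / 2 ≤ q) {n : ℕ}
    {F : Fin n → Measure ℝ} [∀ i, IsProbabilityMeasure (F i)] {w : Equiv.Perm (Fin n) → ℝ}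
    (hw : w ∈ stdSimplex ℝ (Equiv.Perm (Fin n))) (top : Equiv.Perm (Fin n) → Fin n)
    (htop : ∀ π, ∀ᵐ v ∂Measure.pi F, 1 ≤ v (top π) ∧ (∀ j, v j ≤ 2) ∧
      ∀ j, j ≠ top π → 1 ≤ v j → π (top π) < π j)
    {b : ℝ} (hb : ∀ π, ∏ j, (if j = top π then 1 else (F j).real (Iio 2)) = b) :
    revenue (myerson (Freg q h0 h1) w) F = ((2 - b : ℝ) : EReal) := by
  classical
  set R : Equiv.Perm (Fin n) → Set (Fin n → ℝ) := fun π =>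
    univ.pi fun j => if j = top π then univ else Iio 2 with hR
  have hRm : ∀ π, MeasurableSet (R π) := fun π => by
    refine MeasurableSet.univ_pi fun j => ?_
    split_ifs <;> measurability
  have hRb : ∀ π, (Measure.pi F).real (R π) = b := fun π => by
    rw [← hb π, measureReal_def, Measure.pi_pi, ENNReal.toReal_prod]
    refine Finset.prod_congr rfl fun j _ => ?_
    split_ifs <;> simp [measureReal_def]
  have hi : ∀ π, Integrable (fun v => w π * (2 - (R π).indicator (fun _ => (1 : ℝ)) v))
      (Measure.pi F) := fun π =>
    ((integrable_const _).sub ((integrable_const _).indicator (hRm π))).const_mul _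
  rw [revenue_eq_integral (g := fun v => ∑ π, w π * (2 - (R π).indicator (fun _ => (1 : ℝ)) v))]
  · rw [integral_finsetSum _ fun π _ => hi π]
    congr 1
    have : ∀ π, ∫ v, w π * (2 - (R π).indicator (fun _ => (1 : ℝ)) v) ∂Measure.pi F =
        w π * (2 - b) := fun π => by
      rw [integral_const_mul, integral_sub (integrable_const _)
        ((integrable_const _).indicator (hRm π)), integral_indicator_const _ (hRm π), hRb]
      simp
    simp only [this]
    rw [← Finset.sum_mul, hw.2, one_mul]
  · exact integrable_finsetSum _ fun π _ => hi π
  · refine fun v => Finset.sum_nonneg fun π _ => mul_nonneg (hw.1 π) ?_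
    by_cases h : v ∈ R π <;> simp [h]
  · filter_upwards [ae_all_iff.2 htop] with v hv
    simp only [myerson]
    rw [Finset.sum_comm]
    refine Finset.sum_congr rfl fun π _ => ?_
    obtain ⟨e1, e2, e3⟩ := hv π
    rw [← Finset.mul_sum, sum_myerson_pay h0 h1 hq e1 e2 e3]
    have : v ∈ R π ↔ ∀ j, j ≠ top π → v j < 2 := by
      simp only [hR, mem_univ_pi]
      refine forall_congr' fun j => ?_
      split_ifs with h <;> simp [h]
    congr 1
    by_cases h : v ∈ R π
    · rw [if_pos (this.1 h), indicator_of_mem h]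
      norm_num
    · rw [if_neg fun h' => h (this.2 h'), indicator_of_notMem h]
      norm_num

lemma revenue_myerson_iid {q : ℝ} (h0 : 0 < q) (h1 : q < 1) (hq : 1 / 2 ≤ q) {μ : Measure ℝ}
    [IsProbabilityMeasure μ] (hμ : ∀ᵐ s ∂μ, s ∈ Icc (1 : ℝ) 2) {b : ℝ} (hb : μ.real (Iio 2) = b)
    {w : Equiv.Perm (Fin 3) → ℝ} (hw : w ∈ stdSimplex ℝ (Equiv.Perm (Fin 3))) :
    revenue (myerson (Freg q h0 h1) w) (fun _ => μ) = ((2 - b ^ 2 : ℝ) : EReal) := by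
  refine revenue_myerson h0 h1 hq hw (fun π => π.symm 0) (fun π => ?_) fun π => ?_
  · have : ∀ i : Fin 3, ∀ᵐ v ∂Measure.pi (fun _ : Fin 3 => μ), v i ∈ Icc (1 : ℝ) 2 :=
      fun i => Measure.tendsto_eval_ae_ae.eventually hμ
    filter_upwards [ae_all_iff.2 this] with v hv
    refine ⟨(hv _).1, fun j => (hv j).2, fun j hj _ => ?_⟩
    rw [Equiv.apply_symm_apply]
    exact Fin.pos_of_ne_zero fun h => hj (by rw [← h, Equiv.symm_apply_apply])
  · rw [hb, Finset.prod_ite, Finset.prod_const_one, one_mul, Finset.prod_const,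
      Finset.filter_ne', Finset.card_erase_of_mem (Finset.mem_univ _)]
    simp

lemma revenue_myerson_twoBuyers {q : ℝ} (h0 : 0 < q) (h1 : q < 1) (hq : 1 / 2 ≤ q) {H : Measure ℝ}
    [IsProbabilityMeasure H] (hH : ∀ᵐ s ∂H, s ∈ Icc (1 : ℝ) 2) {b : ℝ} (hb : H.real (Iio 2) = b)
    {w : Equiv.Perm (Fin 3) → ℝ} (hw : w ∈ stdSimplex ℝ (Equiv.Perm (Fin 3))) :
    revenue (myerson (Freg q h0 h1) w) (twoBuyers H) = ((2 - b : ℝ) : EReal) := by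
  -- The null buyer bids below `1` and is irrelevant even when first in the order, so `top` is
  -- chosen among the two active buyers; only one competitor is left, whence `b` instead of `b ^ 2`.
  refine revenue_myerson h0 h1 hq hw (fun π => if π 0 < π 1 then 0 else 1) (fun π => ?_) fun π => ?_
  · have a0 : ∀ᵐ v ∂Measure.pi (twoBuyers H), v 0 ∈ Icc (1 : ℝ) 2 :=
      (Measure.tendsto_eval_ae_ae (μ := twoBuyers H) (i := 0)).eventually hH
    have a1 : ∀ᵐ v ∂Measure.pi (twoBuyers H), v 1 ∈ Icc (1 : ℝ) 2 :=
      (Measure.tendsto_eval_ae_ae (μ := twoBuyers H) (i := 1)).eventually hH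
    have a2 : ∀ᵐ v ∂Measure.pi (twoBuyers H), v 2 = 0 :=
      (Measure.tendsto_eval_ae_ae (μ := twoBuyers H) (i := 2)).eventually
        (p := fun s : ℝ => s = 0) (by simp [twoBuyers, ae_dirac_eq])
    filter_upwards [a0, a1, a2] with v h0 h1 h2
    refine ⟨?_, ?_, ?_⟩
    · split_ifs
      exacts [h0.1, h1.1]
    · intro j
      fin_cases j
      exacts [h0.2, h1.2, by simp [h2]]
    · intro j hj h1j
      have hj2 : j ≠ 2 := by
        rintro rfl
        rw [h2] at h1j
        linarith
      have hne : π 0 ≠ π 1 := fun h => absurd (π.injective h) (by decide)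
      split_ifs at hj ⊢ with h
      · have : j = 1 := by fin_cases j <;> simp_all
        rwa [this]
      · have : j = 0 := by fin_cases j <;> simp_all
        rw [this]
        exact lt_of_le_of_ne (not_lt.1 h) hne.symm
  · rw [Fin.prod_univ_three]
    split_ifs <;> simp_all [twoBuyers, measureReal_def]

/-! ### Two i.i.d. buyers with a prescribed law of the minimum -/

/-- The distribution function of two i.i.d. variables whose minimum has law `G`. -/
noncomputable def minRootStieltjes (G : Measure ℝ) : StieltjesFunction ℝ where
  toFun t := 1 - √(1 - ProbabilityTheory.cdf G t)
  mono' x y hxy := by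
    exact sub_le_sub_left (Real.sqrt_le_sqrt
      (sub_le_sub_left (ProbabilityTheory.monotone_cdf G hxy) 1)) 1
  right_continuous' x :=
    continuousWithinAt_const.sub
      ((continuousWithinAt_const.sub ((ProbabilityTheory.cdf G).right_continuous x)).sqrt)

/-- The common law of two i.i.d. variables whose minimum has law `G`. -/
noncomputable def minRoot (G : Measure ℝ) : Measure ℝ := (minRootStieltjes G).measure

lemma minRootStieltjes_tendsto_atBot (G : Measure ℝ) :
    Filter.Tendsto (minRootStieltjes G) Filter.atBot (nhds 0) := by
  have := (((ProbabilityTheory.tendsto_cdf_atBot G).const_sub 1).sqrt).const_sub 1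
  rw [show (1 : ℝ) - √(1 - 0) = 0 by norm_num] at this
  exact this

lemma minRootStieltjes_tendsto_atTop (G : Measure ℝ) :
    Filter.Tendsto (minRootStieltjes G) Filter.atTop (nhds 1) := by
  have := (((ProbabilityTheory.tendsto_cdf_atTop G).const_sub 1).sqrt).const_sub 1
  rw [show (1 : ℝ) - √(1 - 1) = 1 by norm_num] at this
  exact this

instance (G : Measure ℝ) : IsProbabilityMeasure (minRoot G) :=
  StieltjesFunction.isProbabilityMeasure _ (minRootStieltjes_tendsto_atBot G)
    (minRootStieltjes_tendsto_atTop G)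

lemma minRoot_Ioi_sq (G : Measure ℝ) [IsProbabilityMeasure G] (t : ℝ) :
    minRoot G (Ioi t) ^ 2 = G (Ioi t) := by
  have e1 : minRoot G (Ioi t) = ENNReal.ofReal √(1 - ProbabilityTheory.cdf G t) := by
    rw [minRoot, StieltjesFunction.measure_Ioi _ (minRootStieltjes_tendsto_atTop G)]
    congr 1
    exact sub_sub_cancel _ _
  have h1 : 0 ≤ 1 - ProbabilityTheory.cdf G t := by
    linarith [ProbabilityTheory.cdf_le_one G t]
  rw [e1, ← ENNReal.ofReal_pow (Real.sqrt_nonneg _), Real.sq_sqrt h1,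
    ENNReal.ofReal_sub _ (ProbabilityTheory.cdf_nonneg G t), ENNReal.ofReal_one,
    ProbabilityTheory.ofReal_cdf, ← compl_Iic, prob_compl_eq_one_sub measurableSet_Iic]

/-- Closed half-lines are needed to read off the masses at and above `1` and `2`; `t > 0` keeps the
null buyer out. -/
lemma twoBuyers_Ici_sq {G H : Measure ℝ} [IsProbabilityMeasure H]
    (h : twoBuyers H ∈ ambiguitySet 3 2 G) {t : ℝ} (ht : 0 < t) :
    H (Ici t) ^ 2 = G (Ici t) := by
  rw [← h.2, orderStatLaw_Ici, pi_twoBuyers_twoIn H measurableSet_Ici (by simpa using ht)]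

lemma ae_Icc_of_Ici_Ioi {H : Measure ℝ} [IsProbabilityMeasure H] (h1 : H (Ici 1) = 1)
    (h2 : H (Ioi 2) = 0) : ∀ᵐ s ∂H, s ∈ Icc (1 : ℝ) 2 := by
  have e1 : ∀ᵐ s ∂H, s ∈ Ici (1 : ℝ) := (prob_compl_eq_zero_iff measurableSet_Ici).2 h1
  have e2 : ∀ᵐ s ∂H, s ∈ (Ioi (2 : ℝ))ᶜ := measure_eq_zero_iff_ae_notMem.1 h2
  filter_upwards [e1, e2] with s hs1 hs2 using ⟨hs1, not_lt.1 hs2⟩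

/-! ### The two-point distribution -/

lemma Fdisc_apply {r : ℝ} {A : Set ℝ} (hA : MeasurableSet A) :
    Fdisc r A = ENNReal.ofReal r * A.indicator 1 1 + ENNReal.ofReal (1 - r) * A.indicator 1 2 := by
  simp [Fdisc, hA]

lemma Fdisc_ae_mem_Icc (r : ℝ) : ∀ᵐ s ∂Fdisc r, s ∈ Icc (1 : ℝ) 2 := by
  change Fdisc r (Icc 1 2)ᶜ = 0
  rw [Fdisc_apply measurableSet_Icc.compl]
  simp

lemma Fdisc_Iio_two {r : ℝ} (h0 : 0 ≤ r) : (Fdisc r).real (Iio 2) = r := by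
  rw [measureReal_def, Fdisc_apply measurableSet_Iio]
  simp [h0]

lemma Fdisc_Ioi {r : ℝ} (h0 : 0 ≤ r) (h1 : r ≤ 1) (t : ℝ) :
    Fdisc r (Ioi t) = ENNReal.ofReal (if t < 1 then 1 else if t < 2 then 1 - r else 0) := by
  rw [Fdisc_apply measurableSet_Ioi]
  split_ifs with ht1 ht2
  · rw [indicator_of_mem (show (1 : ℝ) ∈ Ioi t from ht1), indicator_of_mem (show (2 : ℝ) ∈ Ioi t from ht1.trans one_lt_two),
      Pi.one_apply, Pi.one_apply, mul_one, mul_one, ← ENNReal.ofReal_add h0 (by linarith)]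
    congr 1
    ring
  · rw [indicator_of_notMem (show (1 : ℝ) ∉ Ioi t from ht1),
      indicator_of_mem (show (2 : ℝ) ∈ Ioi t from ht2)]
    simp
  · rw [indicator_of_notMem (show (1 : ℝ) ∉ Ioi t from ht1),
      indicator_of_notMem (show (2 : ℝ) ∉ Ioi t from ht2)]
    simp

lemma opt_twoBuyers_Fdisc_le {r : ℝ} (hr : 1 / 2 ≤ r) (hr1 : r < 1) :
    opt (twoBuyers (Fdisc r)) ≤ ((2 - r : ℝ) : EReal) := by
  have hr0 : 0 < r := by linarith
  have := isProbabilityMeasure_Fdisc hr0.le hr1.le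
  have hinv2 : 1 / r ≤ 2 := by rw [div_le_iff₀ hr0]; linarith
  have hinv0 : 0 < 1 / r := by positivity
  set φ : ℝ → ℝ := fun s => if s < 2 then 2 - 1 / r else 2 with hφ
  have hφm : Measurable φ := Measurable.ite measurableSet_Iio measurable_const measurable_const
  have hφ0 : ∀ s, 0 ≤ φ s := fun s => by simp only [hφ]; split_ifs <;> linarith
  have hφ2 : ∀ s, φ s ≤ 2 := fun s => by simp only [hφ]; split_ifs <;> linarith
  have hφa : ∀ s, s < 2 → φ s ≤ 2 - 1 / r := fun s hs => by simp [hφ, hs]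
  refine (opt_le_of_two_level (F := twoBuyers (Fdisc r)) (φ := ![φ, φ, fun _ => 0])
    (a := 2 - 1 / r) (b := r ^ 2) ?_ ?_ ?_ ?_ (by linarith) ?_ ?_ ?_).trans ?_
  · have := null_Iio_zero_of_ae_Icc (Fdisc_ae_mem_Icc r)
    intro i
    fin_cases i <;> simp [twoBuyers, this]
  · intro i
    fin_cases i
    exacts [hφm, hφm, measurable_const]
  · intro i
    fin_cases i
    exacts [hφ0, hφ0, fun _ => le_rfl]
  · intro i
    fin_cases i
    exacts [virtualBound_Fdisc hr hr1, virtualBound_Fdisc hr hr1, virtualBound_dirac_zero]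
  · intro i
    fin_cases i
    exacts [hφa, hφa, fun _ _ => show (0 : ℝ) ≤ _ by linarith]
  · intro i
    fin_cases i
    exacts [hφ2, hφ2, fun _ => zero_le_two]
  · rw [Fin.prod_univ_three]
    simp [twoBuyers, Fdisc_Iio_two hr0.le, measureReal_def (Measure.dirac (0 : ℝ)), sq]
  · refine EReal.coe_le_coe_iff.2 (le_of_eq ?_)
    field_simp
    ring

/-- A worst case is at most the revenue at any single member of the ambiguity set. -/
lemma robustRevenue_le_opt {n k : ℕ} {G : Measure ℝ} {F : Fin n → Measure ℝ}
    (hF : F ∈ ambiguitySet n k G) : robustRevenue n k G ≤ opt F :=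
  iSup_mono fun _ => iInf₂_le F hF

/-! ### Three i.i.d. buyers against two i.i.d. buyers -/

section Comparison

variable {q : ℝ}

/-- The cubic increases on `[0, 1]` and is only `1/2` at `q = 1/2`. -/
lemma one_half_le_of_cubic (h1 : q < 1) (h0 : 0 < q) (hq : 3 / 4 ≤ 3 * q ^ 2 - 2 * q ^ 3) :
    1 / 2 ≤ q := by
  by_contra h
  nlinarith [mul_pos h0 h0, mul_pos (mul_pos h0 h0) (sub_pos.2 h1)]

/-- The probability with which each of two i.i.d. two-point values is `2`, for the second-largest
value to have the same law as for three i.i.d. values. -/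
lemma tail_root_bounds {p : ℝ} (h1 : q < 1) (h0 : 0 < q)
    (hq : 3 / 4 ≤ 3 * q ^ 2 - 2 * q ^ 3) (hp0 : 0 ≤ p)
    (hp : p ^ 2 = (1 - q) ^ 2 * (3 - 2 * (1 - q))) :
    0 < p ∧ p ≤ 1 / 2 ∧ 2 - (1 - p) < 2 - q ^ 2 := by
  have hpos : 0 < (1 - q) ^ 2 := by
    have : 0 < 1 - q := by linarith
    positivity
  refine ⟨lt_of_le_of_ne hp0 fun h => ?_, ?_, ?_⟩
  · rw [← h] at hp
    nlinarith
  -- Here `p² = 1 - (3q² - 2q³) ≤ 1/4`.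
  · by_contra h
    nlinarith
  -- After division by `(1 - q)²` the squared inequality is `1 + 2q < (1 + q)²`.
  · have : p < 1 - q ^ 2 := by
      refine lt_of_pow_lt_pow_left₀ 2 (by nlinarith) ?_
      rw [hp]
      nlinarith [mul_pos hpos (mul_pos h0 h0)]
    linarith

lemma robustRevenue_Gdisc_lt (h0 : 0 < q) (h1 : q < 1) (hq : 3 / 4 ≤ 3 * q ^ 2 - 2 * q ^ 3) :
    robustRevenue 3 2 (orderStatLaw 2 fun _ : Fin 3 => Fdisc q) <
      opt (fun _ : Fin 3 => Fdisc q) := by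
  have hhalf := one_half_le_of_cubic h1 h0 hq
  have := isProbabilityMeasure_Fdisc h0.le h1.le
  have hp2 : 0 ≤ (1 - q) ^ 2 * (3 - 2 * (1 - q)) := mul_nonneg (sq_nonneg _) (by linarith)
  set p := √((1 - q) ^ 2 * (3 - 2 * (1 - q)))
  have hp : p ^ 2 = (1 - q) ^ 2 * (3 - 2 * (1 - q)) := Real.sq_sqrt hp2
  obtain ⟨b1, b2, b3⟩ := tail_root_bounds h1 h0 hq (Real.sqrt_nonneg _) hp
  have hH := isProbabilityMeasure_Fdisc (q := 1 - p) (by linarith) (by linarith)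
  have hG : ∀ t, orderStatLaw 2 (fun _ : Fin 3 => Fdisc q) (Ioi t) =
      Fdisc (1 - p) (Ioi t) ^ 2 := by
    intro t
    rw [orderStatLaw_Ioi, pi_twoIn_same _ measurableSet_Ioi _ _ (Fdisc_Ioi h0.le h1.le t),
      Fdisc_Ioi (by linarith) (by linarith), ← ENNReal.ofReal_pow]
    · congr 1
      split_ifs
      · norm_num
      · rw [← hp, sub_sub_cancel]
      · norm_num
    · split_ifs <;> linarith
    · split_ifs <;> linarith
    · split_ifs <;> linarith
  have hGneg : orderStatLaw 2 (fun _ : Fin 3 => Fdisc q) (Iio 0) = 0 := by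
    rw [← compl_Ici, prob_compl_eq_zero_iff measurableSet_Ici]
    refine le_antisymm prob_le_one ?_
    refine le_trans (le_of_eq ?_) (measure_mono (Ioi_subset_Ici_self (a := (0 : ℝ))))
    rw [hG, Fdisc_Ioi (by linarith) (by linarith), if_pos one_pos]
    simp
  have hmem := twoBuyers_mem_ambiguitySet (H := Fdisc (1 - p)) hGneg
    (null_Iio_zero_of_ae_Icc (Fdisc_ae_mem_Icc _)) fun t _ => (hG t).symm
  -- Lexicographic tie-breaking. Myerson's auction for `Freg` serves as the lower bound for three
  -- draws from `Fdisc q`: its revenue depends only on the mass `q` below `2`.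
  have hw := single_mem_stdSimplex ℝ (1 : Equiv.Perm (Fin 3))
  calc robustRevenue 3 2 (orderStatLaw 2 fun _ : Fin 3 => Fdisc q)
      ≤ opt (twoBuyers (Fdisc (1 - p))) := robustRevenue_le_opt hmem
    _ ≤ ((2 - (1 - p) : ℝ) : EReal) := opt_twoBuyers_Fdisc_le (by linarith) (by linarith)
    _ < ((2 - q ^ 2 : ℝ) : EReal) := EReal.coe_lt_coe_iff.2 b3
    _ = revenue (myerson (Freg q h0 h1) (Pi.single 1 1)) (fun _ : Fin 3 => Fdisc q) :=
        (revenue_myerson_iid h0 h1 hhalf (Fdisc_ae_mem_Icc q) (Fdisc_Iio_two h0.le) hw).symm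
    _ ≤ opt (fun _ : Fin 3 => Fdisc q) :=
        le_iSup (fun M : {M : Mechanism 3 // M.Admissible} => revenue M.1 fun _ => Fdisc q)
          ⟨_, myerson_admissible (monotone_virtualValue_Freg h0 h1) hw⟩

lemma worstCase_myerson_lt (h0 : 0 < q) (h1 : q < 1) (hq : 3 / 4 ≤ 3 * q ^ 2 - 2 * q ^ 3)
    {w : Equiv.Perm (Fin 3) → ℝ} (hw : w ∈ stdSimplex ℝ (Equiv.Perm (Fin 3))) :
    worstCase (myerson (Freg q h0 h1) w) 2 (orderStatLaw 2 fun _ : Fin 3 => Freg q h0 h1) <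
      ((2 - q ^ 2 : ℝ) : EReal) := by
  have hhalf := one_half_le_of_cubic h1 h0 hq
  set G := orderStatLaw 2 fun _ : Fin 3 => Freg q h0 h1 with hGdef
  have hGIci : ∀ (t s : ℝ), 0 ≤ s → s ≤ 1 → Freg q h0 h1 (Ici t) = ENNReal.ofReal s →
      G (Ici t) = ENNReal.ofReal (s ^ 2 * (3 - 2 * s)) := fun t s hs0 hs1 hs => by
    rw [hGdef, orderStatLaw_Ici, pi_twoIn_same _ measurableSet_Ici hs0 hs1 hs]
  have hF1 : Freg q h0 h1 (Ici 1) = ENNReal.ofReal 1 := by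
    rw [ENNReal.ofReal_one, ← prob_compl_eq_zero_iff measurableSet_Ici]
    exact (Freg_ae_mem_Icc h0 h1).mono fun s hs => hs.1
  have hG1 : G (Ici 1) = 1 := by
    rw [hGIci 1 1 zero_le_one le_rfl hF1]
    norm_num
  have hG2 : G (Ioi 2) = 0 := by
    rw [hGdef, orderStatLaw_Ioi, pi_twoIn_same _ measurableSet_Ioi le_rfl zero_le_one]
    · simp
    · rw [Freg_Ioi, regCDF, if_neg (by norm_num), if_neg (by norm_num), sub_self]
  have hGneg : G (Iio 0) = 0 := by
    rw [← compl_Ici, prob_compl_eq_zero_iff measurableSet_Ici]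
    exact le_antisymm prob_le_one (hG1 ▸ measure_mono (Ici_subset_Ici.2 zero_le_one))
  have hHneg : minRoot G (Iio 0) = 0 := by
    -- The square relation is so far known only on open half-lines, so a threshold strictly between
    -- `0` and `1` is used.
    have h : minRoot G (Ioi (1 / 2)) = 1 := by
      have : G (Ioi (1 / 2)) = 1 := le_antisymm prob_le_one
        (hG1 ▸ measure_mono fun s hs => lt_of_lt_of_le (by norm_num) (mem_Ici.1 hs))
      rw [← minRoot_Ioi_sq] at this
      exact le_antisymm prob_le_one
        (this ▸ pow_le_of_le_one zero_le prob_le_one two_ne_zero)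
    rw [← compl_Ici, prob_compl_eq_zero_iff measurableSet_Ici]
    exact le_antisymm prob_le_one
      (h ▸ measure_mono fun s hs => le_trans (by norm_num) (mem_Ioi.1 hs).le)
  have hmem := twoBuyers_mem_ambiguitySet hGneg hHneg fun t _ => minRoot_Ioi_sq G t
  have hH1 : minRoot G (Ici 1) = 1 := by
    have := twoBuyers_Ici_sq hmem one_pos
    rw [hG1] at this
    exact le_antisymm prob_le_one
        (this ▸ pow_le_of_le_one zero_le prob_le_one two_ne_zero)
  have hH2 : minRoot G (Ioi 2) = 0 := by
    have := minRoot_Ioi_sq G 2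
    rw [hG2] at this
    simpa using this
  -- The mass of `minRoot G` on `[2, ∞)` satisfies the equation defining `p` in the two-point case,
  -- so the same comparison applies.
  have hp : (minRoot G).real (Ici 2) ^ 2 = (1 - q) ^ 2 * (3 - 2 * (1 - q)) := by
    rw [measureReal_def, ← ENNReal.toReal_pow, twoBuyers_Ici_sq hmem two_pos,
      hGIci 2 (1 - q) (by linarith) (by linarith) (Freg_Ici_two h0 h1),
      ENNReal.toReal_ofReal (mul_nonneg (sq_nonneg _) (by linarith))]
  obtain ⟨-, -, b3⟩ := tail_root_bounds h1 h0 hq measureReal_nonneg hp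
  have hb : (minRoot G).real (Iio 2) = 1 - (minRoot G).real (Ici 2) := by
    rw [← compl_Ici, probReal_compl_eq_one_sub measurableSet_Ici]
  refine lt_of_le_of_lt (iInf₂_le _ hmem) ?_
  rw [revenue_myerson_twoBuyers h0 h1 hhalf (ae_Icc_of_Ici_Ioi hH1 hH2) hb hw]
  exact EReal.coe_lt_coe_iff.2 b3

end Comparison

end OrderStatAuction

open OrderStatAuction
theorem mainTheorem9 (q : ℝ) (hq0 : 0 < q) (hq1 : q < 1) (hq : 3 / 4 ≤ 3 * q ^ 2 - 2 * q ^ 3)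
    (Gdisc Greg : Measure ℝ)
    (hGdisc : Gdisc = orderStatLaw 2 (fun _ : Fin 3 => Fdisc q))
    (hGreg : Greg = orderStatLaw 2 (fun _ : Fin 3 => Freg q hq0 hq1)) :
    robustRevenue 3 2 Gdisc < opt (fun _ : Fin 3 => Fdisc q) ∧
    ((secondPrice 3 0).Admissible ∧
      robustRevenue 3 2 Greg = worstCase (secondPrice 3 0) 2 Greg ∧
      ∃ F ∈ ambiguitySet 3 2 Greg,
        revenue (secondPrice 3 0) F = worstCase (secondPrice 3 0) 2 Greg) ∧
    ∀ w ∈ stdSimplex ℝ (Equiv.Perm (Fin 3)),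
      (myerson (Freg q hq0 hq1) w).Admissible ∧
      revenue (myerson (Freg q hq0 hq1) w) (fun _ : Fin 3 => Freg q hq0 hq1) =
        opt (fun _ : Fin 3 => Freg q hq0 hq1) ∧
      worstCase (myerson (Freg q hq0 hq1) w) 2 Greg < worstCase (secondPrice 3 0) 2 Greg := by
  subst hGdisc hGreg
  have hhalf := one_half_le_of_cubic hq1 hq0 hq
  have hmem : (fun _ : Fin 3 => Freg q hq0 hq1) ∈
      ambiguitySet 3 2 (orderStatLaw 2 fun _ : Fin 3 => Freg q hq0 hq1) :=
    ⟨fun _ => ⟨inferInstance, null_Iio_zero_of_ae_Icc (Freg_ae_mem_Icc hq0 hq1)⟩, rfl⟩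
  have hworst := worstCase_secondPrice hmem
  have hlow := le_revenue_secondPrice_Freg hq0 hq1
  have hopt := opt_Freg_le hq0 hq1 hhalf
  have hupper := (robustRevenue_le_opt hmem).trans hopt
  refine ⟨robustRevenue_Gdisc_lt hq0 hq1 hq, ⟨secondPrice_admissible, le_antisymm ?_ ?_,
    _, hmem, hworst.symm⟩, fun w hw => ?_⟩
  · rw [hworst]
    exact hupper.trans hlow
  · exact le_iSup (fun M : {M : Mechanism 3 // M.Admissible} => worstCase M.1 2
      (orderStatLaw 2 fun _ : Fin 3 => Freg q hq0 hq1)) ⟨_, secondPrice_admissible⟩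
  have hadm := myerson_admissible (monotone_virtualValue_Freg hq0 hq1) hw
  refine ⟨hadm, le_antisymm ?_ ?_, ?_⟩
  · exact le_iSup (fun M : {M : Mechanism 3 // M.Admissible} =>
      revenue M.1 fun _ => Freg q hq0 hq1) ⟨_, hadm⟩
  · rw [revenue_myerson_iid hq0 hq1 hhalf (Freg_ae_mem_Icc hq0 hq1) (Freg_Iio_two hq0 hq1) hw]
    exact hopt
  · rw [hworst]
    exact (worstCase_myerson_lt hq0 hq1 hq hw).trans_le hlow
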